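/- **Notation.** Quaternions are $\mathbb R^4=\mathbb R\times\mathbb R^3$ with the Hamilton product $\circ$ and conjugation $*$; $\operatorname{aug}(x)=(0,x)$ for $x\in\mathbb R^3$, and $\operatorname{red}$ takes the vector part. Dual numbers are $a+\epsilon b$ with $\epsilon^2=0$; products, cross products, conjugation, $\operatorname{aug}$ and $\operatorname{red}$ are extended to dual quaternions and dual vectors $\mathring x=x_r+\epsilon x_c$ ($x_r,x_c\in\mathbb R^3$) accordingly. Let $\operatorname{crs}(\mathring x,\mathring y)=x_r^\top y_c+x_c^\top y_r$, $\operatorname{exch}(\mathring x)=x_c+\epsilon x_r$, $\operatorname{real}(\mathring x)=x_r$, $\operatorname{comp}(\mathring x)=x_c$, let $\operatorname{sgn}$ act componentwise with $\operatorname{sgn}(0)=0$, and $$\operatorname{func}(\mathring x,\mathring y,\mathring z)=(\|y_r\times y_c+z_c\|_2+1)\operatorname{sgn}(x_c)+\epsilon(\|y_r\|_2^2+\|z_r\|_2+1)\operatorname{sgn}(x_r).$$ **Plant.** Let $m>0$, let $J\in\mathbb R^{3\times3}$ be symmetric positive definite, $\mathring M(x_r+\epsilon x_c)=m x_c+\epsilon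 Jx_r$, and $0=h_0<h_1<\dots<h_s=T$, $s\ge1$. The desired pose is $\mathring Q_d=Q_d+\epsilon\frac12Q_d\circ\operatorname{aug}(P_d)$ with $Q_d(t)$ a unit quaternion and $P_d(t)\in\mathbb R^3$; it satisfies $\dot{\mathring Q}_d=\frac12\mathring Q_d\circ\operatorname{aug}(\mathring\omega_d)$ on $[0,T]$, where $\mathring\omega_d$ is differentiable and $\mathring\omega_d,\dot{\mathring\omega}_d$ are bounded on $[0,T]$. In iteration $k=0,1,2,\dots$ the body has pose $\mathring Q_k=Q_k+\epsilon\frac12Q_k\circ\operatorname{aug}(P_k)$, with $Q_k(t)$ a unit quaternion, and dual velocity $\mathring\omega_k$, with $$\dot{\mathring Q}_k=\tfrac12\mathring Q_k\circ\operatorname{aug}(\mathring\omega_k),\qquad \mathring M\dot{\mathring\omega}_k=-\mathring\omega_k\times\mathring M\mathring\omega_k+\mathring f_k+\mathring d_k\qquad\text{on }[0,T],$$ where $\mathring f_k$ is the control input and $\mathring d_k=d_k+\epsilon s_k$ the disturbance, $\|d_k(t)\|\le\beta_d(t)$, $\|s_k(t)\|\le\beta_s(t)$ for all $k$ and $t\in[0,T]$,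 with $\beta_d,\beta_s$ bounded on $[0,T]$. Put $\delta\mathring Q_k=\mathring Q_d^*\circ\mathring Q_k$, with real part $\delta Q_k=Q_d^*\circ Q_k$, and $\delta q_k=\operatorname{red}(\delta Q_k)$, $\delta P_k=P_k-\operatorname{red}(\delta Q_k^*\circ\operatorname{aug}(P_d)\circ\delta Q_k)$, $\operatorname{tr}(\mathring x)=\operatorname{red}(\delta\mathring Q_k^*\circ\operatorname{aug}(\mathring x)\circ\delta\mathring Q_k)$, $\delta\mathring\omega_k=\mathring\omega_k-\operatorname{tr}(\mathring\omega_d)$. Assume that for every $k$ there is a sign $\varsigma_k\in\{1,-1\}$ with $\delta\mathring Q_k(0)=\varsigma_k\mathbf 1+\epsilon\mathbf 0$, where $\mathbf 1=(1,0,0,0)$, and that $\delta\mathring\omega_k(0)=0$. **Control.** Let $k_p,k_d,k_c,k_\theta,k_l>0$. The control input is $$\mathring f_k=-\hat\theta_k\operatorname{func}(\delta\mathring\omega_k,\operatorname{tr}(\mathring\omega_d),\operatorname{tr}(\dot{\mathring\omega}_d))-k_d\operatorname{exch}(\delta\mathring\omega_k)-\epsilon k_p\operatorname{red}(\operatorname{real}(\delta\mathring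 Q_k))-k_p\operatorname{red}(\operatorname{real}(\delta\mathring Q_k^*)\circ\operatorname{comp}(\delta\mathring Q_k)).$$ For $t\in[0,T]$ let $p(t)=\min\{j\in\{1,\dots,s\}:h_j\ge t\}$, and for $x:[0,T]\to\mathbb R$ let $\operatorname{proj}(x(t))=\max\{x(t),\ \sup_{\tau\in(h_{p(t)-1},h_{p(t)}]}x(\tau)-k_c\}$. The estimates satisfy $\hat\theta_0=0$ and, for $k\ge1$ and $t\in[0,T]$, $$\hat\theta_k(t)-\operatorname{proj}(\hat\theta_{k-1}(t))=\min\Big\{k_l,\ k_\theta\operatorname{crs}\big(\delta\mathring\omega_k(t),\operatorname{func}(\delta\mathring\omega_k(t),\operatorname{tr}(\mathring\omega_d(t)),\operatorname{tr}(\dot{\mathring\omega}_d(t)))\big)\Big\}.$$ Since $\operatorname{sgn}$ is discontinuous, solutions are understood in the sense of Filippov: $\mathring\omega_k$ is absolutely continuous, the dynamics hold for almost every $t$, and in $\mathring f_k$ the sign of a vanishing component of $\delta\mathring\omega_k(t)$ may take any value in $[-1,1]$; solutions with $\operatorname{sgn}(0)=0$ are a special case. **Theorem.** For every such sequence of closed-loop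 solutions on $[0,T]$: 1. (perfect position-attitude tracking) for every $t\in[0,T]$, $\lim_{k\to\infty}\|\delta P_k(t)\|_2=0$, $\lim_{k\to\infty}\|\delta q_k(t)\|_2=0$, and $\lim_{k\to\infty}\varsigma_k\mathring Q_k(t)=\mathring Q_d(t)$; in particular $\mathring Q_k(t)\to\mathring Q_d(t)$ if all $\varsigma_k=1$; 2. (boundedness) the real and dual parts of $\mathring f_k(t)$, $\delta\mathring Q_k(t)$ and $\delta\mathring\omega_k(t)$, and the estimates $\hat\theta_k(t)$, are bounded uniformly in $k\ge0$ and $t\in[0,T]$. -/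

import Mathlib

open scoped Quaternion

noncomputable section

namespace DualILC

/-- Euclidean three-space. -/
abbrev E3 := EuclideanSpace ℝ (Fin 3)

/-- Dual vectors `x_r + ε x_c` in dimension three: `x.1 = x_r` is the real part and `x.2 = x_c` the
dual part. -/
abbrev DualVec := E3 × E3

/-- Dual quaternions `Q_r + ε Q_c`: dual numbers over Hamilton's quaternions, so that the product is
`Q_r Q_r' + ε (Q_r Q_c' + Q_c Q_r')`. -/
abbrev DualQuat := DualNumber ℍ[ℝ]

/-- Dual quaternion from its real and dual parts. -/
def mkDQ (a b : ℍ[ℝ]) : DualQuat := TrivSqZeroExt.inl a + TrivSqZeroExt.inr b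

/-- The real part of a dual quaternion. -/
def re (Q : DualQuat) : ℍ[ℝ] := TrivSqZeroExt.fst Q

/-- The dual part of a dual quaternion. -/
def du (Q : DualQuat) : ℍ[ℝ] := TrivSqZeroExt.snd Q

/-- Conjugation `Q* = Q_r* + ε Q_c*`. -/
def conj (Q : DualQuat) : DualQuat := mkDQ (star (re Q)) (star (du Q))

/-- A vector of `ℝ³` as a quaternion with zero scalar part. -/
def aug (x : E3) : ℍ[ℝ] := ⟨0, x 0, x 1, x 2⟩

/-- The vector part of a quaternion. -/
def red (Q : ℍ[ℝ]) : E3 := !₂[Q.imI, Q.imJ, Q.imK]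

def dualAug (x : DualVec) : DualQuat := mkDQ (aug x.1) (aug x.2)

def dualRed (Q : DualQuat) : DualVec := (red (re Q), red (du Q))

/-- The cross product on Euclidean three-space. -/
def cross (x y : E3) : E3 := WithLp.toLp 2 (crossProduct x.ofLp y.ofLp)

/-- The cross product of dual vectors. -/
def dualCross (x y : DualVec) : DualVec := (cross x.1 y.1, cross x.1 y.2 + cross x.2 y.1)

/-- `crs(x, y) = x_rᵀ y_c + x_cᵀ y_r`. -/
def crs (x y : DualVec) : ℝ := inner ℝ x.1 y.2 + inner ℝ x.2 y.1

/-- `exch(x_r + ε x_c) = x_c + ε x_r`. -/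
def exch (x : DualVec) : DualVec := (x.2, x.1)

/-- The dual inertia operator `m I₃ d/dε + ε J`, i.e. `x_r + ε x_c ↦ m x_c + ε J x_r`. -/
def inertia (m : ℝ) (J : Matrix (Fin 3) (Fin 3) ℝ) (x : DualVec) : DualVec :=
  (m • x.2, WithLp.toLp 2 (J.mulVec x.1.ofLp))

/-- The unit dual quaternion `Q + ε ½ Q ∘ aug(P)` of the pose with attitude `Q` and position `P`. -/
def pose (Q : ℍ[ℝ]) (P : E3) : DualQuat := mkDQ Q ((1 / 2 : ℝ) • (Q * aug P))

/-- The dual quaternion error `Q_d* ∘ Q`. -/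
def poseErr (Qd Q : DualQuat) : DualQuat := conj Qd * Q

/-- The position error `P - red(δQ* ∘ aug(P_d) ∘ δQ)`, where `δQ = Q_d* ∘ Q`. -/
def posErr (Qd : ℍ[ℝ]) (Pd : E3) (Q : ℍ[ℝ]) (P : E3) : E3 :=
  P - red (star (star Qd * Q) * aug Pd * (star Qd * Q))

/-- The vector part of the attitude error `Q_d* ∘ Q`. -/
def attErr (Qd Q : ℍ[ℝ]) : E3 := red (star Qd * Q)

/-- `tr(x) = red(δQ* ∘ aug(x) ∘ δQ)`. -/
def tr (δQ : DualQuat) (x : DualVec) : DualVec := dualRed (conj δQ * dualAug x * δQ)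

/-- The dual velocity error `ω - tr(ω_d)`. -/
def velErr (δQ : DualQuat) (ωd ω : DualVec) : DualVec := ω - tr δQ ωd

/-- The componentwise sign, with `sgn 0 = 0`. -/
def sgn (x : E3) : E3 := WithLp.toLp 2 (fun i => Real.sign (x i))

def dualSgn (x : DualVec) : DualVec := (sgn x.1, sgn x.2)

/-- The set-valued sign: `{sgn x}` for `x ≠ 0`, and `[-1, 1]` at `x = 0`. -/
def SgnSet (x : ℝ) : Set ℝ := if x = 0 then Set.Icc (-1) 1 else {Real.sign x}

/-- `σ` is a componentwise selection of the set-valued sign of `x`. -/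
def IsSgnSelection (σ x : DualVec) : Prop :=
  (∀ i, σ.1 i ∈ SgnSet (x.1 i)) ∧ (∀ i, σ.2 i ∈ SgnSet (x.2 i))

/-- The single-valued sign (with `sgn 0 = 0`) is such a selection. -/
theorem isSgnSelection_dualSgn (x : DualVec) : IsSgnSelection (dualSgn x) x := by
  have h : ∀ r : ℝ, Real.sign r ∈ SgnSet r := by
    intro r
    by_cases hr : r = 0
    · simp [SgnSet, hr]
    · simp [SgnSet, hr]
  exact ⟨fun i => h _, fun i => h _⟩

/-- `(‖y_r × y_c + z_c‖ + 1) σ_c + ε (‖y_r‖² + ‖z_r‖ + 1) σ_r`, where `σ` stands for the sign of the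
first argument of `func`. -/
def funcOfSgn (σ y z : DualVec) : DualVec :=
  ((‖cross y.1 y.2 + z.2‖ + 1) • σ.2, (‖y.1‖ ^ 2 + ‖z.1‖ + 1) • σ.1)

/-- `func(x, y, z)`. -/
def func (x y z : DualVec) : DualVec := funcOfSgn (dualSgn x) y z

/-- The control law
`-θ̂ func(δω, tr ω_d, tr ω_d') - k_d exch(δω) - ε k_p red(real δQ) - k_p red(real(δQ*) ∘ comp(δQ))`,
where `σ` is the value used for `sgn(δω)` in `func`. -/
def control (kp kd θ : ℝ) (σ : DualVec) (δQ : DualQuat) (δω ωd ωd' : DualVec) : DualVec :=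
  -(θ • funcOfSgn σ (tr δQ ωd) (tr δQ ωd')) - kd • exch δω
    - (0, kp • red (re δQ)) - (kp • red (re (conj δQ) * du δQ), 0)

/-- The index `p(t) = min {j ∈ {1, …, s} : h_j ≥ t}` of the segment containing `t`. -/
def segIndex (s : ℕ) (h : ℕ → ℝ) (t : ℝ) : ℕ := sInf {j : ℕ | 1 ≤ j ∧ j ≤ s ∧ t ≤ h j}

/-- The segment `(h_{p(t)-1}, h_{p(t)}]`. -/
def segment (s : ℕ) (h : ℕ → ℝ) (t : ℝ) : Set ℝ :=
  Set.Ioc (h (segIndex s h t - 1)) (h (segIndex s h t))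

open Classical in
/-- The segment-based dynamic projection of width `kc` of the function `x`, at time `t`. -/
def proj (s : ℕ) (h : ℕ → ℝ) (kc : ℝ) (x : ℝ → ℝ) (t : ℝ) : ℝ :=
  if x t > sSup (x '' segment s h t) - kc then x t else sSup (x '' segment s h t) - kc

end DualILC

end

/-!
The kinetic energy `E = crs(δω, M δω) / 2` is equivalent to `‖δω‖²`. The gyroscopic terms are
dominated by `C g`, where `g = crs(δω, func(δω, tr ω_d, tr ω_d'))` is the signal that drives the
learning law and `‖δω‖ ≤ g`, so that `E' ≤ (C - θ) g + R` with `R` collecting feedback and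
disturbance.

Since `θ ≥ 0`, Gronwall's inequality for `E + ‖dual δQ‖² + 1` bounds `δω` and `δQ` uniformly in the
iteration, and then `R ≤ C' g`. Hence once `θ` exceeds a threshold `Θ` throughout a segment, `E`
does not increase there, and `g` on the segment is at most a constant times `g` at its left
endpoint.

The estimates accumulate the signals, so bounded estimates give summable signals. Conversely the
projection prevents an estimate from falling more than `kc` below the supremum of its predecessor
over the segment. So an estimate that dips below `Θ` somewhere is at most `Θ + kc + kl` on the whole
segment, and any other estimate has grown by at most a multiple of `g` at the left endpoint. As
`g = 0` at time `0`, induction over the segments bounds all estimates and all sums of signals. The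
velocity errors are therefore summable, their time integrals tend to `0`, and these integrals
dominate the pose errors.
-/

noncomputable section

namespace DualILC

open MeasureTheory Set Filter

section AbsoluteContinuity

theorem absolutelyContinuous_comp_of_locallyLipschitz {E Y : Type*}
    [SeminormedAddCommGroup E] [PseudoMetricSpace Y] {g : E → Y} (hg : LocallyLipschitz g)
    {f : ℝ → E} {a b : ℝ}
    (hf : AbsolutelyContinuousOnInterval f a b) :
    AbsolutelyContinuousOnInterval (fun t => g (f t)) a b := by
  obtain ⟨K, hK⟩ := LocallyLipschitzOn.exists_lipschitzOnWith_of_compact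
    (isCompact_uIcc.image_of_continuousOn hf.continuousOn) hg.locallyLipschitzOn
  rw [absolutelyContinuousOnInterval_iff] at hf ⊢
  intro ε hε
  obtain ⟨δ, hδ, hfδ⟩ := hf (ε / (K + 1)) (by positivity)
  refine ⟨δ, hδ, fun I hI hlen => ?_⟩
  calc ∑ i ∈ Finset.range I.1, dist (g (f (I.2 i).1)) (g (f (I.2 i).2))
      ≤ ∑ i ∈ Finset.range I.1, (K + 1) * dist (f (I.2 i).1) (f (I.2 i).2) := by
        refine Finset.sum_le_sum fun i hi => ?_
        refine (hK.dist_le_mul _ (mem_image_of_mem f (hI.1 i hi).1) _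
          (mem_image_of_mem f (hI.1 i hi).2)).trans ?_
        gcongr
        exact le_add_of_nonneg_right zero_le_one
    _ = (K + 1) * ∑ i ∈ Finset.range I.1, dist (f (I.2 i).1) (f (I.2 i).2) :=
        (Finset.mul_sum ..).symm
    _ < (K + 1) * (ε / (K + 1)) := by
        gcongr
        exact hfδ I hI hlen
    _ = ε := mul_div_cancel₀ ε (by positivity)

theorem absolutelyContinuous_prodMk {X Y : Type*} [PseudoMetricSpace X] [PseudoMetricSpace Y]
    {f : ℝ → X} {g : ℝ → Y} {a b : ℝ} (hf : AbsolutelyContinuousOnInterval f a b)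
    (hg : AbsolutelyContinuousOnInterval g a b) :
    AbsolutelyContinuousOnInterval (fun t => (f t, g t)) a b := by
  refine squeeze_zero (fun I => Finset.sum_nonneg fun i _ => dist_nonneg) (fun I => ?_)
    (by simpa using Tendsto.add hf hg)
  rw [← Finset.sum_add_distrib]
  exact Finset.sum_le_sum fun i _ => max_le_add_of_nonneg dist_nonneg dist_nonneg

theorem absolutelyContinuous_of_hasDerivWithinAt {E : Type*} [NormedAddCommGroup E]
    [NormedSpace ℝ E] {f f' : ℝ → E} {a b C : ℝ} (hab : a ≤ b)
    (hf : ∀ t ∈ Icc a b, HasDerivWithinAt f (f' t) (Icc a b) t)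
    (hC : ∀ t ∈ Icc a b, ‖f' t‖ ≤ C) : AbsolutelyContinuousOnInterval f a b := by
  have hC₀ : 0 ≤ C := (norm_nonneg _).trans (hC a ⟨le_rfl, hab⟩)
  have hlip := Convex.lipschitzOnWith_of_nnnorm_hasDerivWithin_le (C := ⟨C, hC₀⟩)
    (convex_Icc a b) hf hC
  rw [← uIcc_of_le hab] at hlip
  exact hlip.absolutelyContinuousOnInterval

theorem ae_Icc_mem_nhds (a b : ℝ) : ∀ᵐ t, t ∈ Icc a b → Icc a b ∈ nhds t := by
  filter_upwards [Measure.ae_ne volume a, Measure.ae_ne volume b] with t hta htb ht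
  exact Icc_mem_nhds (lt_of_le_of_ne ht.1 hta.symm) (lt_of_le_of_ne ht.2 htb)

theorem le_of_ae_hasDerivAt_nonpos {V : ℝ → ℝ} {a b : ℝ} (hab : a ≤ b)
    (hV : AbsolutelyContinuousOnInterval V a b)
    (h : ∀ᵐ t, t ∈ Ioc a b → ∃ v, HasDerivAt V v t ∧ v ≤ 0) : V b ≤ V a := by
  have hnonpos : deriv V ≤ᵐ[volume.restrict (Ioc a b)] 0 := by
    rw [EventuallyLE, ae_restrict_iff' measurableSet_Ioc]
    filter_upwards [h] with t ht hmem
    obtain ⟨v, hv, hv₀⟩ := ht hmem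
    simpa only [hv.deriv, Pi.zero_apply] using hv₀
  rw [← sub_nonpos, ← hV.integral_deriv_eq_sub, intervalIntegral.integral_of_le hab]
  exact setIntegral_nonpos_of_ae_restrict hnonpos

theorem le_mul_exp_of_ae_hasDerivAt_le {V : ℝ → ℝ} {a b C : ℝ} (hab : a ≤ b)
    (hV : AbsolutelyContinuousOnInterval V a b)
    (h : ∀ᵐ t, t ∈ Ioc a b → ∃ v, HasDerivAt V v t ∧ v ≤ C * V t) :
    V b ≤ V a * Real.exp (C * (b - a)) := by
  have hexp : AbsolutelyContinuousOnInterval (fun t => Real.exp (-C * (t - a))) a b :=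
    ContDiffOn.absolutelyContinuousOnInterval (ContDiff.contDiffOn (by fun_prop))
  have hexp' (t : ℝ) :
      HasDerivAt (fun τ => Real.exp (-C * (τ - a))) (Real.exp (-C * (t - a)) * -C) t := by
    simpa using (((hasDerivAt_id t).sub_const a).const_mul (-C)).exp
  have hdecay : V b * Real.exp (-C * (b - a)) ≤ V a * Real.exp (-C * (a - a)) := by
    refine le_of_ae_hasDerivAt_nonpos hab (hV.fun_mul hexp) ?_
    filter_upwards [h] with t ht hmem
    obtain ⟨v, hv, hvC⟩ := ht hmem
    refine ⟨_, hv.mul (hexp' t), ?_⟩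
    have := mul_nonneg (sub_nonneg.2 hvC) (Real.exp_pos (-C * (t - a))).le
    linarith
  rw [sub_self, mul_zero, Real.exp_zero, mul_one, neg_mul, Real.exp_neg] at hdecay
  exact (mul_inv_le_iff₀ (Real.exp_pos _)).1 hdecay

theorem norm_sub_le_integral {E : Type*} [NormedAddCommGroup E] [NormedSpace ℝ E] [CompleteSpace E]
    {f f' : ℝ → E} {e : ℝ → ℝ} {a b C : ℝ} (hab : a ≤ b)
    (hf : ∀ t ∈ Icc a b, HasDerivWithinAt f (f' t) (Icc a b) t)
    (hf' : ContinuousOn f' (Icc a b)) (he : ContinuousOn e (Icc a b))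
    (hC : ∀ t ∈ Icc a b, ‖f' t‖ ≤ C * e t) : ‖f b - f a‖ ≤ C * ∫ t in a..b, e t := by
  rw [← intervalIntegral.integral_eq_sub_of_hasDerivAt_of_le hab
    (fun t ht => (hf t ht).continuousWithinAt)
    (fun t ht => (hf t (Ioo_subset_Icc_self ht)).hasDerivAt (Icc_mem_nhds ht.1 ht.2))
    (hf'.intervalIntegrable_of_Icc hab), ← intervalIntegral.integral_const_mul]
  exact intervalIntegral.norm_integral_le_of_norm_le hab
    (Eventually.of_forall fun t ht => hC t (Ioc_subset_Icc_self ht))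
    ((continuousOn_const.mul he).intervalIntegrable_of_Icc hab)

theorem tendsto_integral_of_sum_le {e : ℕ → ℝ → ℝ} {a b B : ℝ} (hab : a ≤ b)
    (he : ∀ k, ContinuousOn (e k) (Icc a b)) (he₀ : ∀ k, ∀ t ∈ Icc a b, 0 ≤ e k t)
    (hB : ∀ t ∈ Icc a b, ∀ n, ∑ k ∈ Finset.range n, e k t ≤ B) :
    Tendsto (fun k => ∫ t in a..b, e k t) atTop (nhds 0) := by
  have hint (k : ℕ) : IntervalIntegrable (e k) volume a b := (he k).intervalIntegrable_of_Icc hab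
  refine (summable_of_sum_range_le (c := ∫ _ in a..b, B)
    (fun k => intervalIntegral.integral_nonneg hab (he₀ k)) fun n => ?_).tendsto_atTop_zero
  rw [← intervalIntegral.integral_finsetSum fun k _ => hint k]
  exact intervalIntegral.integral_mono_on hab
    ((continuousOn_finsetSum _ fun k _ => he k).intervalIntegrable_of_Icc hab)
    intervalIntegrable_const fun t ht => hB t ht n

theorem exists_bound_of_hasDerivWithinAt {E : Type*} [NormedAddCommGroup E] [NormedSpace ℝ E]
    {f f' : ℝ → E} {a b : ℝ} (hf : ∀ t ∈ Icc a b, HasDerivWithinAt f (f' t) (Icc a b) t)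
    (hf' : ∃ B, ∀ t ∈ Icc a b, ‖f' t‖ ≤ B) :
    ∃ B, (∀ t ∈ Icc a b, ‖f t‖ ≤ B) ∧ ∀ t ∈ Icc a b, ‖f' t‖ ≤ B := by
  obtain ⟨B, hB⟩ := isCompact_Icc.exists_bound_of_continuousOn
    fun t ht => (hf t ht).continuousWithinAt
  obtain ⟨B', hB'⟩ := hf'
  exact ⟨max B B', fun t ht => le_max_of_le_left (hB t ht),
    fun t ht => le_max_of_le_right (hB' t ht)⟩

end AbsoluteContinuity

section Learning

/-- The saturated learning update of the estimates `θ k`, driven by nonnegative signals `g k`, at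
the points of `D`. The projection is taken over the window `W t`; in the theorem `W t` is the
segment containing `t`. -/
structure IsLearningUpdate {α : Type*} (kc kl kθ : ℝ) (D : Set α) (W : α → Set α)
    (θ g : ℕ → α → ℝ) : Prop where
  zero : ∀ t ∈ D, θ 0 t = 0
  succ : ∀ k, ∀ t ∈ D,
    θ (k + 1) t = max (θ k t) (sSup (θ k '' W t) - kc) + min kl (kθ * g (k + 1) t)
  signal_nonneg : ∀ k, ∀ t ∈ D, 0 ≤ g k t

namespace IsLearningUpdate

variable {α : Type*} {kc kl kθ : ℝ} {D I : Set α} {W : α → Set α} {θ g : ℕ → α → ℝ}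

theorem increment_nonneg (H : IsLearningUpdate kc kl kθ D W θ g) (hkl : 0 ≤ kl) (hkθ : 0 ≤ kθ)
    (k : ℕ) {t : α} (ht : t ∈ D) : 0 ≤ min kl (kθ * g k t) :=
  le_min hkl (mul_nonneg hkθ (H.signal_nonneg k t ht))

theorem add_increment_le_succ (H : IsLearningUpdate kc kl kθ D W θ g) (k : ℕ) {t : α}
    (ht : t ∈ D) : θ k t + min kl (kθ * g (k + 1) t) ≤ θ (k + 1) t := by
  rw [H.succ k t ht]
  gcongr
  exact le_max_left _ _

theorem sum_increment_le (H : IsLearningUpdate kc kl kθ D W θ g) (n : ℕ) {t : α} (ht : t ∈ D) :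
    ∑ k ∈ Finset.range n, min kl (kθ * g (k + 1) t) ≤ θ n t := by
  induction n with
  | zero => simp [H.zero t ht]
  | succ n ih =>
    rw [Finset.sum_range_succ]
    linarith [H.add_increment_le_succ n ht]

theorem nonneg (H : IsLearningUpdate kc kl kθ D W θ g) (hkl : 0 ≤ kl) (hkθ : 0 ≤ kθ) (n : ℕ)
    {t : α} (ht : t ∈ D) : 0 ≤ θ n t :=
  (Finset.sum_nonneg fun k _ => H.increment_nonneg hkl hkθ (k + 1) ht).trans
    (H.sum_increment_le n ht)

theorem le_nat_mul (H : IsLearningUpdate kc kl kθ D W θ g) (hkc : 0 ≤ kc)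
    (hID : I ⊆ D) (hW : ∀ t ∈ I, W t = I) (n : ℕ) {t : α} (ht : t ∈ I) : θ n t ≤ n * kl := by
  induction n generalizing t with
  | zero => simp [H.zero t (hID ht)]
  | succ n ih =>
    have hsup : sSup (θ n '' I) ≤ n * kl := csSup_le ⟨_, t, ht, rfl⟩ (forall_mem_image.2 @ih)
    calc θ (n + 1) t = max (θ n t) (sSup (θ n '' I) - kc) + min kl (kθ * g (n + 1) t) := by
          rw [H.succ n t (hID ht), hW t ht]
      _ ≤ n * kl + kl := add_le_add (max_le (ih ht) (by linarith)) (min_le_left _ _)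
      _ = (n + 1 : ℕ) * kl := by push_cast; ring

theorem le_sSup (H : IsLearningUpdate kc kl kθ D W θ g) (hkc : 0 ≤ kc)
    (hID : I ⊆ D) (hW : ∀ t ∈ I, W t = I) (n : ℕ) {t : α} (ht : t ∈ I) :
    θ n t ≤ sSup (θ n '' I) :=
  le_csSup ⟨_, forall_mem_image.2 fun _ => H.le_nat_mul hkc hID hW n⟩ (mem_image_of_mem _ ht)

/- If `θ (n + 1)` dips below `Θ` anywhere on `I`, the projection forces the preceding estimate below
`Θ + kc` on all of `I`; otherwise the increment is at most `kθ * r (n + 1)`. -/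
theorem le_threshold_add (H : IsLearningUpdate kc kl kθ D W θ g) (hkc : 0 ≤ kc) (hkl : 0 ≤ kl)
    (hkθ : 0 ≤ kθ) (hID : I ⊆ D) (hW : ∀ t ∈ I, W t = I) {Θ : ℝ} (hΘ : 0 ≤ Θ) {r : ℕ → ℝ}
    (hr : ∀ k, 0 ≤ r k) (hgr : ∀ k, (∀ t ∈ I, Θ ≤ θ k t) → ∀ t ∈ I, g k t ≤ r k) (n : ℕ) {t : α}
    (ht : t ∈ I) : θ n t ≤ Θ + kc + kl + kθ * ∑ k ∈ Finset.range (n + 1), r k := by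
  have hsum (n : ℕ) : 0 ≤ kθ * ∑ k ∈ Finset.range n, r k :=
    mul_nonneg hkθ (Finset.sum_nonneg fun k _ => hr k)
  induction n generalizing t with
  | zero =>
    rw [H.zero t (hID ht)]
    linarith [hsum (0 + 1)]
  | succ n ih =>
    rw [H.succ n t (hID ht), hW t ht]
    by_cases hall : ∀ t ∈ I, Θ ≤ θ (n + 1) t
    · have hsup : sSup (θ n '' I) ≤ Θ + kc + kl + kθ * ∑ k ∈ Finset.range (n + 1), r k :=
        csSup_le ⟨_, t, ht, rfl⟩ (forall_mem_image.2 @ih)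
      have hincr : min kl (kθ * g (n + 1) t) ≤ kθ * r (n + 1) :=
        (min_le_right _ _).trans (mul_le_mul_of_nonneg_left (hgr _ hall t ht) hkθ)
      rw [Finset.sum_range_succ, mul_add, ← add_assoc]
      exact add_le_add (max_le (ih ht) (by linarith)) hincr
    · push Not at hall
      obtain ⟨t₀, ht₀, hlt⟩ := hall
      have hsup : sSup (θ n '' I) - kc ≤ Θ := by
        have := H.succ n t₀ (hID ht₀)
        rw [hW t₀ ht₀] at this
        linarith [le_max_right (θ n t₀) (sSup (θ n '' I) - kc),
          H.increment_nonneg hkl hkθ (n + 1) (hID ht₀)]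
      have hmax := max_le (by linarith [H.le_sSup hkc hID hW n ht] : θ n t ≤ Θ + kc)
        (by linarith : sSup (θ n '' I) - kc ≤ Θ + kc)
      linarith [min_le_left kl (kθ * g (n + 1) t), hsum (n + 1 + 1)]

theorem sum_signal_le (H : IsLearningUpdate kc kl kθ D W θ g) (hkl : 0 < kl) (hkθ : 0 < kθ)
    {G B : ℝ} (hG : 0 < G) {t : α} (ht : t ∈ D) (hgG : ∀ k, g k t ≤ G) (hB : ∀ n, θ n t ≤ B)
    (n : ℕ) : ∑ k ∈ Finset.range n, g k t ≤ B / min (kl / G) kθ + G := by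
  have hc : 0 < min (kl / G) kθ := lt_min (div_pos hkl hG) hkθ
  have hincr (k : ℕ) : min (kl / G) kθ * g k t ≤ min kl (kθ * g k t) := by
    have hg := H.signal_nonneg k t ht
    refine le_min ?_ (mul_le_mul_of_nonneg_right (min_le_right _ _) hg)
    calc min (kl / G) kθ * g k t ≤ kl / G * G :=
          mul_le_mul (min_le_left _ _) (hgG k) hg (div_pos hkl hG).le
      _ = kl := div_mul_cancel₀ kl hG.ne'
  calc ∑ k ∈ Finset.range n, g k t ≤ ∑ k ∈ Finset.range (n + 1), g k t :=
        Finset.sum_le_sum_of_subset_of_nonneg (Finset.range_mono n.le_succ)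
          fun k _ _ => H.signal_nonneg k t ht
    _ = ∑ k ∈ Finset.range n, g (k + 1) t + g 0 t := Finset.sum_range_succ' _ n
    _ ≤ B / min (kl / G) kθ + G := by
        gcongr
        · rw [le_div_iff₀' hc, Finset.mul_sum]
          exact (Finset.sum_le_sum fun k _ => hincr (k + 1)).trans
            ((H.sum_increment_le n ht).trans (hB n))
        · exact hgG 0

end IsLearningUpdate

theorem proj_eq_max (s : ℕ) (h : ℕ → ℝ) (kc : ℝ) (x : ℝ → ℝ) (t : ℝ) :
    proj s h kc x t = max (x t) (sSup (x '' segment s h t) - kc) := by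
  rw [max_comm, max_def_lt]
  rfl

variable {s : ℕ} {h : ℕ → ℝ}

theorem segment_eq_Ioc (hh : StrictMonoOn h (Iic s)) {j : ℕ} (hj : j < s) {t : ℝ}
    (ht : t ∈ Ioc (h j) (h (j + 1))) : segment s h t = Ioc (h j) (h (j + 1)) := by
  have hmem : j + 1 ∈ {i : ℕ | 1 ≤ i ∧ i ≤ s ∧ t ≤ h i} := ⟨j.succ_pos, hj, ht.2⟩
  have hidx : segIndex s h t = j + 1 := by
    refine le_antisymm (Nat.sInf_le hmem) (le_csInf ⟨_, hmem⟩ fun i ⟨_, hi, hti⟩ => ?_)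
    exact (hh.lt_iff_lt hj.le hi).1 (ht.1.trans_le hti)
  rw [segment, hidx, Nat.add_sub_cancel]

theorem segment_zero (hh : StrictMonoOn h (Iic s)) (hs : 1 ≤ s) :
    segment s h (h 0) = Ioc (h 0) (h 1) := by
  have hmem : 1 ∈ {i : ℕ | 1 ≤ i ∧ i ≤ s ∧ h 0 ≤ h i} :=
    ⟨le_rfl, hs, hh.monotoneOn (Nat.zero_le s) hs zero_le_one⟩
  have hidx : segIndex s h (h 0) = 1 :=
    le_antisymm (Nat.sInf_le hmem) (le_csInf ⟨_, hmem⟩ fun i hi => hi.1)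
  rw [segment, hidx]

namespace IsLearningUpdate

variable {kc kl kθ Θ C G : ℝ} {θ g : ℕ → ℝ → ℝ}

theorem exists_bound_on_segment (hh : StrictMonoOn h (Iic s))
    (H : IsLearningUpdate kc kl kθ (Icc (h 0) (h s)) (segment s h) θ g)
    (hkc : 0 ≤ kc) (hkl : 0 < kl) (hkθ : 0 < kθ) (hΘ : 0 ≤ Θ) (hC : 0 ≤ C) (hG : 0 < G)
    (hgG : ∀ k, ∀ t ∈ Icc (h 0) (h s), g k t ≤ G)
    (hdecay : ∀ k, ∀ a ∈ Icc (h 0) (h s), ∀ b ∈ Icc a (h s),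
      (∀ t ∈ Ioc a b, Θ ≤ θ k t) → g k b ≤ C * g k a)
    {j : ℕ} (hj : j < s) {B : ℝ} (hB : ∀ n, ∑ k ∈ Finset.range n, g k (h j) ≤ B) :
    ∃ B', ∀ t ∈ Ioc (h j) (h (j + 1)), ∀ n, ∑ k ∈ Finset.range n, g k t ≤ B' ∧ θ n t ≤ B' := by
  have hmem {i : ℕ} (hi : i ≤ s) : h i ∈ Icc (h 0) (h s) :=
    ⟨hh.monotoneOn (Nat.zero_le s) hi i.zero_le, hh.monotoneOn hi self_mem_Iic hi⟩
  have hID : Ioc (h j) (h (j + 1)) ⊆ Icc (h 0) (h s) :=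
    Ioc_subset_Icc_self.trans (Icc_subset_Icc (hmem hj.le).1 (hmem hj).2)
  have hθ (t : ℝ) (ht : t ∈ Ioc (h j) (h (j + 1))) (n : ℕ) :
      θ n t ≤ Θ + kc + kl + kθ * (C * B) := by
    refine (H.le_threshold_add hkc hkl.le hkθ.le hID (fun t => segment_eq_Ioc hh hj) hΘ
      (r := fun k => C * g k (h j))
      (fun k => mul_nonneg hC (H.signal_nonneg k _ (hmem hj.le)))
      (fun k hk t ht => ?_) n ht).trans ?_
    · exact hdecay k (h j) (hmem hj.le) t ⟨ht.1.le, (hID ht).2⟩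
        fun τ hτ => hk τ ⟨hτ.1, hτ.2.trans ht.2⟩
    · rw [← Finset.mul_sum]
      gcongr
      exact hB (n + 1)
  exact ⟨_, fun t ht n => ⟨le_max_of_le_left
    (H.sum_signal_le hkl hkθ hG (hID ht) (fun k => hgG k t (hID ht)) (hθ t ht) n),
    le_max_of_le_right (hθ t ht n)⟩⟩

theorem le_at_zero (hh : StrictMonoOn h (Iic s)) (hs : 1 ≤ s)
    (H : IsLearningUpdate kc kl kθ (Icc (h 0) (h s)) (segment s h) θ g) (hkc : 0 ≤ kc)
    (hinit : ∀ k, g k (h 0) = 0) {B : ℝ} (hB₀ : 0 ≤ B)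
    (hB : ∀ n, ∀ t ∈ Ioc (h 0) (h 1), θ n t ≤ B) (n : ℕ) : θ n (h 0) ≤ B := by
  have hmem : h 0 ∈ Icc (h 0) (h s) :=
    ⟨le_rfl, hh.monotoneOn (Nat.zero_le s) self_mem_Iic s.zero_le⟩
  have hne : (Ioc (h 0) (h 1)).Nonempty :=
    nonempty_Ioc.2 (hh (Nat.zero_le s) hs zero_lt_one)
  induction n with
  | zero => rwa [H.zero _ hmem]
  | succ n ih =>
    have hsup : sSup (θ n '' Ioc (h 0) (h 1)) ≤ B :=
      csSup_le (hne.image _) (forall_mem_image.2 fun t => hB n t)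
    rw [H.succ n _ hmem, segment_zero hh hs, hinit, mul_zero]
    linarith [max_le ih (by linarith : sSup (θ n '' Ioc (h 0) (h 1)) - kc ≤ B),
      min_le_right kl 0]

theorem exists_bound (hh : StrictMonoOn h (Iic s)) (hs : 1 ≤ s)
    (H : IsLearningUpdate kc kl kθ (Icc (h 0) (h s)) (segment s h) θ g)
    (hkc : 0 ≤ kc) (hkl : 0 < kl) (hkθ : 0 < kθ) (hΘ : 0 ≤ Θ) (hC : 0 ≤ C) (hG : 0 < G)
    (hgG : ∀ k, ∀ t ∈ Icc (h 0) (h s), g k t ≤ G) (hinit : ∀ k, g k (h 0) = 0)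
    (hdecay : ∀ k, ∀ a ∈ Icc (h 0) (h s), ∀ b ∈ Icc a (h s),
      (∀ t ∈ Ioc a b, Θ ≤ θ k t) → g k b ≤ C * g k a) :
    ∃ B, ∀ t ∈ Icc (h 0) (h s), ∀ n, ∑ k ∈ Finset.range n, g k t ≤ B ∧ θ n t ≤ B := by
  have hchain (j : ℕ) (hj : j ≤ s) : ∃ B, 0 ≤ B ∧ ∀ t ∈ Icc (h 0) (h j), ∀ n,
      ∑ k ∈ Finset.range n, g k t ≤ B ∧ (h 0 < t → θ n t ≤ B) := by
    induction j with
    | zero =>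
      refine ⟨0, le_rfl, fun t ht n => ?_⟩
      obtain rfl : t = h 0 := le_antisymm ht.2 ht.1
      simp [hinit]
    | succ j ih =>
      obtain ⟨B, hB₀, hB⟩ := ih (Nat.le_of_succ_le hj)
      have hle : h 0 ≤ h j := hh.monotoneOn (Nat.zero_le s) (Nat.le_of_succ_le hj) j.zero_le
      obtain ⟨B', hB'⟩ := H.exists_bound_on_segment hh hkc hkl hkθ hΘ hC hG hgG hdecay hj
        fun n => (hB (h j) ⟨hle, le_rfl⟩ n).1
      refine ⟨max B B', le_max_of_le_left hB₀, fun t ht n => ?_⟩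
      rcases le_or_gt t (h j) with htj | htj
      · have := hB t ⟨ht.1, htj⟩ n
        exact ⟨le_max_of_le_left this.1, fun h₀ => le_max_of_le_left (this.2 h₀)⟩
      · have := hB' t ⟨htj, ht.2⟩ n
        exact ⟨le_max_of_le_right this.1, fun _ => le_max_of_le_right this.2⟩
  obtain ⟨B, hB₀, hB⟩ := hchain s le_rfl
  have hfirst : Ioc (h 0) (h 1) ⊆ Icc (h 0) (h s) :=
    Ioc_subset_Icc_self.trans (Icc_subset_Icc le_rfl (hh.monotoneOn hs self_mem_Iic hs))
  refine ⟨B, fun t ht n => ⟨(hB t ht n).1, ?_⟩⟩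
  rcases ht.1.eq_or_lt with rfl | hpos
  · exact H.le_at_zero hh hs hkc hinit hB₀ (fun n t ht => (hB t (hfirst ht) n).2 ht.1) n
  · exact (hB t ht n).2 hpos

end IsLearningUpdate

end Learning

section DualQuaternions

@[simp] theorem re_mkDQ (a b : ℍ[ℝ]) : re (mkDQ a b) = a := by simp [re, mkDQ]

@[simp] theorem du_mkDQ (a b : ℍ[ℝ]) : du (mkDQ a b) = b := by simp [du, mkDQ]

theorem dualQuat_ext {A B : DualQuat} (hre : re A = re B) (hdu : du A = du B) : A = B :=
  TrivSqZeroExt.ext hre hdu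

@[simp] theorem re_mul (A B : DualQuat) : re (A * B) = re A * re B := rfl

@[simp] theorem du_mul (A B : DualQuat) : du (A * B) = re A * du B + du A * re B := by
  simp [du, re, TrivSqZeroExt.snd_mul]

@[simp] theorem re_smul (r : ℝ) (A : DualQuat) : re (r • A) = r • re A := rfl

@[simp] theorem du_smul (r : ℝ) (A : DualQuat) : du (r • A) = r • du A := rfl

@[simp] theorem re_add (A B : DualQuat) : re (A + B) = re A + re B := rfl

@[simp] theorem du_add (A B : DualQuat) : du (A + B) = du A + du B := rfl

@[simp] theorem re_sub (A B : DualQuat) : re (A - B) = re A - re B := rfl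

@[simp] theorem du_sub (A B : DualQuat) : du (A - B) = du A - du B := rfl

@[simp] theorem re_neg (A : DualQuat) : re (-A) = -re A := rfl

@[simp] theorem du_neg (A : DualQuat) : du (-A) = -du A := rfl

@[simp] theorem re_one : re 1 = 1 := rfl

@[simp] theorem du_one : du 1 = 0 := rfl

@[simp] theorem re_conj (A : DualQuat) : re (conj A) = star (re A) := re_mkDQ _ _

@[simp] theorem du_conj (A : DualQuat) : du (conj A) = star (du A) := du_mkDQ _ _

@[simp] theorem re_dualAug (x : DualVec) : re (dualAug x) = aug x.1 := re_mkDQ _ _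

@[simp] theorem du_dualAug (x : DualVec) : du (dualAug x) = aug x.2 := du_mkDQ _ _

@[simp] theorem aug_re (x : E3) : (aug x).re = 0 := rfl

@[simp] theorem aug_imI (x : E3) : (aug x).imI = x 0 := rfl

@[simp] theorem aug_imJ (x : E3) : (aug x).imJ = x 1 := rfl

@[simp] theorem aug_imK (x : E3) : (aug x).imK = x 2 := rfl

/-- `aug` as a continuous linear map. -/
def augCLM : E3 →L[ℝ] ℍ[ℝ] :=
  LinearMap.toContinuousLinearMap
    { toFun := aug
      map_add' := fun x y => by ext <;> simp
      map_smul' := fun r x => by ext <;> simp }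

/-- `red` as a continuous linear map. -/
def redCLM : ℍ[ℝ] →L[ℝ] E3 :=
  LinearMap.toContinuousLinearMap
    { toFun := red
      map_add' := fun a b => by ext i; fin_cases i <;> simp [red]
      map_smul' := fun r a => by ext i; fin_cases i <;> simp [red] }

/-- The real part of a dual quaternion as a continuous linear map. -/
def reCLM : DualQuat →L[ℝ] ℍ[ℝ] where
  toFun := re
  map_add' := re_add
  map_smul' := re_smul
  cont := TrivSqZeroExt.continuous_fst

/-- The dual part of a dual quaternion as a continuous linear map. -/
def duCLM : DualQuat →L[ℝ] ℍ[ℝ] where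
  toFun := du
  map_add' := du_add
  map_smul' := du_smul
  cont := TrivSqZeroExt.continuous_snd

/-- `mkDQ` as a continuous linear map. -/
def mkDQCLM : ℍ[ℝ] × ℍ[ℝ] →L[ℝ] DualQuat where
  toFun p := mkDQ p.1 p.2
  map_add' p q := by apply dualQuat_ext <;> simp
  map_smul' r p := by apply dualQuat_ext <;> simp
  cont := (TrivSqZeroExt.continuous_inl.comp continuous_fst).add
    (TrivSqZeroExt.continuous_inr.comp continuous_snd)

/-- Conjugation of dual quaternions as a continuous linear map. -/
def conjCLM : DualQuat →L[ℝ] DualQuat where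
  toFun := conj
  map_add' A B := by apply dualQuat_ext <;> simp
  map_smul' r A := by apply dualQuat_ext <;> simp
  cont := mkDQCLM.continuous.comp
    ((continuous_star.comp reCLM.continuous).prodMk (continuous_star.comp duCLM.continuous))

/-- `dualAug` as a continuous linear map. -/
def dualAugCLM : DualVec →L[ℝ] DualQuat := mkDQCLM ∘L augCLM.prodMap augCLM

/-- `dualRed` as a continuous linear map. -/
def dualRedCLM : DualQuat →L[ℝ] DualVec := (redCLM ∘L reCLM).prod (redCLM ∘L duCLM)

theorem conj_mul (A B : DualQuat) : conj (A * B) = conj B * conj A := by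
  apply dualQuat_ext <;> simp [add_comm]

theorem conj_conj (A : DualQuat) : conj (conj A) = A := by
  apply dualQuat_ext <;> simp

theorem conj_smul (r : ℝ) (A : DualQuat) : conj (r • A) = r • conj A :=
  map_smul conjCLM r A

theorem dualQuat_smul_mul (r : ℝ) (A B : DualQuat) : (r • A) * B = r • (A * B) := by
  apply dualQuat_ext <;> simp [smul_add]

theorem dualQuat_mul_smul (r : ℝ) (A B : DualQuat) : A * (r • B) = r • (A * B) := by
  apply dualQuat_ext <;> simp [smul_add]

@[simp] theorem star_aug (x : E3) : star (aug x) = -aug x := by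
  ext <;> simp

theorem conj_dualAug (x : DualVec) : conj (dualAug x) = -dualAug x := by
  apply dualQuat_ext <;> simp

theorem dualAug_sub (x y : DualVec) : dualAug (x - y) = dualAug x - dualAug y :=
  map_sub dualAugCLM x y

theorem aug_red {a : ℍ[ℝ]} (ha : star a = -a) : aug (red a) = a := by
  have hre : a.re = 0 := self_eq_neg.1 (by simpa using congrArg QuaternionAlgebra.re ha)
  ext <;> simp [red, hre]

theorem dualAug_dualRed {A : DualQuat} (hA : conj A = -A) : dualAug (dualRed A) = A := by
  have hre : star (re A) = -re A := by rw [← re_conj, hA, re_neg]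
  have hdu : star (du A) = -du A := by rw [← du_conj, hA, du_neg]
  apply dualQuat_ext <;> simp [dualRed, aug_red, hre, hdu]

theorem dualAug_tr (A : DualQuat) (x : DualVec) : dualAug (tr A x) = conj A * dualAug x * A := by
  refine dualAug_dualRed ?_
  rw [conj_mul, conj_mul, conj_conj, conj_dualAug]
  noncomm_ring

theorem cross_apply (x y : E3) :
    cross x y = !₂[x 1 * y 2 - x 2 * y 1, x 2 * y 0 - x 0 * y 2, x 0 * y 1 - x 1 * y 0] := by
  simp [cross, crossProduct]

theorem red_commutator (a : ℍ[ℝ]) (x : E3) :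
    red ((1 / 2 : ℝ) • (a * aug x - aug x * a)) = cross (red a) x := by
  rw [cross_apply]
  ext i
  fin_cases i <;> simp [red] <;> ring

theorem dualRed_commutator (A : DualQuat) (x : DualVec) :
    dualRed ((1 / 2 : ℝ) • (A * dualAug x - dualAug x * A)) = dualCross (dualRed A) x := by
  refine Prod.ext ?_ ?_
  · simp only [dualRed, dualCross, re_smul, re_sub, re_mul, re_dualAug, red_commutator]
  calc red (du ((1 / 2 : ℝ) • (A * dualAug x - dualAug x * A)))
      = red ((1 / 2 : ℝ) • (re A * aug x.2 - aug x.2 * re A)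
          + (1 / 2 : ℝ) • (du A * aug x.1 - aug x.1 * du A)) := by
        simp only [du_smul, du_sub, du_mul, re_dualAug, du_dualAug, ← smul_add]
        congr 2
        abel
    _ = cross (red (re A)) x.2 + cross (red (du A)) x.1 := by
        rw [← red_commutator, ← red_commutator]
        exact map_add redCLM _ _

theorem pose_mul_conj {Q : ℍ[ℝ]} (hQ : ‖Q‖ = 1) (P : E3) : pose Q P * conj (pose Q P) = 1 := by
  have hQQ : Q * star Q = 1 := by
    rw [Quaternion.self_mul_star, Quaternion.normSq_eq_norm_mul_self, hQ, one_mul,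
      Quaternion.coe_one]
  apply dualQuat_ext
  · simp [pose, hQQ]
  · simp [pose, mul_assoc]

theorem conj_mul_pose {Q : ℍ[ℝ]} (hQ : ‖Q‖ = 1) (P : E3) : conj (pose Q P) * pose Q P = 1 := by
  have hQQ : star Q * Q = 1 := by
    rw [Quaternion.star_mul_self, Quaternion.normSq_eq_norm_mul_self, hQ, one_mul,
      Quaternion.coe_one]
  apply dualQuat_ext
  · simp [pose, hQQ]
  · have haug : star Q * (Q * aug P) = aug P := by rw [← mul_assoc, hQQ, one_mul]
    simp [pose, mul_assoc, hQQ, haug]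

theorem poseErr_mul_conj {A B : DualQuat} (hA : conj A * A = 1) (hB : B * conj B = 1) :
    poseErr A B * conj (poseErr A B) = 1 := by
  rw [poseErr, conj_mul, conj_conj, mul_assoc, ← mul_assoc B, hB, one_mul, hA]

variable {A B : ℝ → DualQuat} {A' B' : DualQuat} {S : Set ℝ} {t : ℝ}

theorem hasDerivWithinAt_conj (hA : HasDerivWithinAt A A' S t) :
    HasDerivWithinAt (fun τ => conj (A τ)) (conj A') S t :=
  conjCLM.hasFDerivAt.comp_hasDerivWithinAt t hA

theorem hasDerivWithinAt_dualQuat_mul (hA : HasDerivWithinAt A A' S t)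
    (hB : HasDerivWithinAt B B' S t) :
    HasDerivWithinAt (fun τ => A τ * B τ) (A' * B t + A t * B') S t :=
  HasDerivWithinAt.mul (𝕜 := ℝ) (𝔸 := DualQuat) hA hB

theorem hasDerivWithinAt_poseErr {u w : DualVec}
    (hA : HasDerivWithinAt A ((1 / 2 : ℝ) • (A t * dualAug u)) S t)
    (hB : HasDerivWithinAt B ((1 / 2 : ℝ) • (B t * dualAug w)) S t)
    (hAA : conj (A t) * A t = 1) (hBB : B t * conj (B t) = 1) :
    HasDerivWithinAt (fun τ => poseErr (A τ) (B τ))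
      ((1 / 2 : ℝ) • (poseErr (A t) (B t) * dualAug (velErr (poseErr (A t) (B t)) u w))) S t := by
  refine (hasDerivWithinAt_dualQuat_mul (hasDerivWithinAt_conj hA) hB).congr_deriv ?_
  have hvel : poseErr (A t) (B t) * dualAug (velErr (poseErr (A t) (B t)) u w)
      = poseErr (A t) (B t) * dualAug w - dualAug u * poseErr (A t) (B t) := by
    rw [velErr, dualAug_sub, dualAug_tr, mul_sub, ← mul_assoc, ← mul_assoc,
      poseErr_mul_conj hAA hBB, one_mul]
  rw [hvel, poseErr, conj_smul, conj_mul, conj_dualAug, dualQuat_smul_mul,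
    dualQuat_mul_smul, ← smul_add]
  congr 1
  noncomm_ring

theorem hasDerivWithinAt_tr {u : ℝ → DualVec} {u' x : DualVec}
    (hA : HasDerivWithinAt A ((1 / 2 : ℝ) • (A t * dualAug x)) S t)
    (hu : HasDerivWithinAt u u' S t) :
    HasDerivWithinAt (fun τ => tr (A τ) (u τ))
      (tr (A t) u' + dualCross (tr (A t) (u t)) x) S t := by
  have haug : HasDerivWithinAt (fun τ => dualAug (u τ)) (dualAug u') S t :=
    dualAugCLM.hasFDerivAt.comp_hasDerivWithinAt t hu
  refine (dualRedCLM.hasFDerivAt.comp_hasDerivWithinAt t (hasDerivWithinAt_dualQuat_mul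
    (hasDerivWithinAt_dualQuat_mul (hasDerivWithinAt_conj hA) haug) hA)).congr_deriv ?_
  have hsplit : (conj ((1 / 2 : ℝ) • (A t * dualAug x)) * dualAug (u t)
        + conj (A t) * dualAug u') * A t
        + conj (A t) * dualAug (u t) * ((1 / 2 : ℝ) • (A t * dualAug x))
      = conj (A t) * dualAug u' * A t
        + (1 / 2 : ℝ) • (conj (A t) * dualAug (u t) * A t * dualAug x
          - dualAug x * (conj (A t) * dualAug (u t) * A t)) := by
    rw [conj_smul, conj_mul, conj_dualAug, dualQuat_smul_mul, add_mul, dualQuat_smul_mul,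
      dualQuat_mul_smul, smul_sub]
    simp only [neg_mul, smul_neg, mul_assoc]
    abel
  calc dualRedCLM _ = dualRedCLM _ := congrArg dualRedCLM hsplit
    _ = tr (A t) u' + _ := map_add dualRedCLM _ _
    _ = _ := congrArg (tr (A t) u' + ·) (dualRed_commutator _ _)

theorem tr_fst (A : DualQuat) (u : DualVec) :
    (tr A u).1 = red (star (re A) * aug u.1 * re A) := by
  simp [tr, dualRed]

theorem tr_snd (A : DualQuat) (u : DualVec) :
    (tr A u).2 = red (star (re A) * aug u.1 * du A
      + (star (re A) * aug u.2 + star (du A) * aug u.1) * re A) := by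
  simp [tr, dualRed]

theorem contDiff_tr : ContDiff ℝ 1 fun p : DualQuat × DualVec => tr p.1 p.2 := by
  have hre : ContDiff ℝ 1 fun p : DualQuat × DualVec => re p.1 :=
    reCLM.contDiff.comp contDiff_fst
  have hdu : ContDiff ℝ 1 fun p : DualQuat × DualVec => du p.1 :=
    duCLM.contDiff.comp contDiff_fst
  have hre' : ContDiff ℝ 1 fun p : DualQuat × DualVec => star (re p.1) := by
    simp only [← re_conj]
    exact (reCLM ∘L conjCLM).contDiff.comp contDiff_fst
  have hdu' : ContDiff ℝ 1 fun p : DualQuat × DualVec => star (du p.1) := by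
    simp only [← du_conj]
    exact (duCLM ∘L conjCLM).contDiff.comp contDiff_fst
  have haug₁ : ContDiff ℝ 1 fun p : DualQuat × DualVec => aug p.2.1 :=
    augCLM.contDiff.comp contDiff_snd.fst
  have haug₂ : ContDiff ℝ 1 fun p : DualQuat × DualVec => aug p.2.2 :=
    augCLM.contDiff.comp contDiff_snd.snd
  refine ContDiff.prodMk ?_ ?_
  · simp only [re_mul, re_conj, re_dualAug]
    exact redCLM.contDiff.comp ((hre'.mul haug₁).mul hre)
  · simp only [re_mul, du_mul, re_conj, du_conj, re_dualAug, du_dualAug]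
    exact redCLM.contDiff.comp (((hre'.mul haug₁).mul hdu).add
      (((hre'.mul haug₂).add (hdu'.mul haug₁)).mul hre))

end DualQuaternions

section Norms

theorem norm_sq_quaternion (a : ℍ[ℝ]) :
    ‖a‖ ^ 2 = a.re ^ 2 + a.imI ^ 2 + a.imJ ^ 2 + a.imK ^ 2 := by
  rw [sq, ← Quaternion.normSq_eq_norm_mul_self, Quaternion.normSq_def']

theorem inner_vector (x y : E3) : inner ℝ x y = x 0 * y 0 + x 1 * y 1 + x 2 * y 2 := by
  simp only [PiLp.inner_apply, Fin.sum_univ_three, Real.inner_apply]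

theorem norm_sq_vector (x : E3) : ‖x‖ ^ 2 = x 0 ^ 2 + x 1 ^ 2 + x 2 ^ 2 := by
  rw [← real_inner_self_eq_norm_sq, inner_vector]
  ring

@[simp] theorem norm_aug (x : E3) : ‖aug x‖ = ‖x‖ := by
  rw [← sq_eq_sq₀ (norm_nonneg _) (norm_nonneg _), norm_sq_quaternion, norm_sq_vector]
  simp

theorem norm_red_le (a : ℍ[ℝ]) : ‖red a‖ ≤ ‖a‖ := by
  rw [← sq_le_sq₀ (norm_nonneg _) (norm_nonneg _), norm_sq_quaternion, norm_sq_vector]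
  simp [red, add_assoc, sq_nonneg]

theorem norm_cross_le (x y : E3) : ‖cross x y‖ ≤ ‖x‖ * ‖y‖ := by
  refine (sq_le_sq₀ (norm_nonneg _) (by positivity)).1 ?_
  have lagrange : ‖cross x y‖ ^ 2 = ‖x‖ ^ 2 * ‖y‖ ^ 2 - inner ℝ x y ^ 2 := by
    simp only [norm_sq_vector, inner_vector, cross_apply, Matrix.cons_val]
    ring
  rw [lagrange, mul_pow]
  exact sub_le_self _ (sq_nonneg _)

theorem norm_le_sum_abs {ι : Type*} [Fintype ι] (x : EuclideanSpace ℝ ι) : ‖x‖ ≤ ∑ i, |x i| := by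
  rw [EuclideanSpace.norm_eq]
  exact Real.sqrt_le_iff.2 ⟨Finset.sum_nonneg fun i _ => abs_nonneg _,
    Finset.sum_sq_le_sq_sum_of_nonneg fun i _ => norm_nonneg _⟩

theorem sum_abs_le_card_mul_norm {ι : Type*} [Fintype ι] (x : EuclideanSpace ℝ ι) :
    ∑ i, |x i| ≤ Fintype.card ι * ‖x‖ := by
  rw [← nsmul_eq_mul, Fintype.card]
  exact Finset.sum_le_card_nsmul _ _ _ fun i _ => PiLp.norm_apply_le x i

theorem exists_norm_sq_bounds {E : Type*} [NormedAddCommGroup E] [NormedSpace ℝ E]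
    [FiniteDimensional ℝ E] [Nontrivial E] {q : E → ℝ} (hcont : Continuous q)
    (hhom : ∀ (r : ℝ) x, q (r • x) = r ^ 2 * q x) (hpos : ∀ x ≠ 0, 0 < q x) :
    ∃ c > 0, ∃ C, ∀ x, c * ‖x‖ ^ 2 ≤ q x ∧ q x ≤ C * ‖x‖ ^ 2 := by
  have : ProperSpace E := FiniteDimensional.proper ℝ E
  have hne : (Metric.sphere (0 : E) 1).Nonempty := NormedSpace.sphere_nonempty.2 zero_le_one
  obtain ⟨a, ha, hmin⟩ := (isCompact_sphere (0 : E) 1).exists_isMinOn hne hcont.continuousOn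
  obtain ⟨b, -, hmax⟩ := (isCompact_sphere (0 : E) 1).exists_isMaxOn hne hcont.continuousOn
  refine ⟨q a, hpos a (Metric.ne_of_mem_sphere ha one_ne_zero), q b, fun x => ?_⟩
  rcases eq_or_ne x 0 with rfl | hx
  · have hq₀ : q 0 = 0 := by simpa using hhom 0 0
    simp [hq₀]
  have hunit : ‖x‖⁻¹ • x ∈ Metric.sphere (0 : E) 1 := by simp [norm_smul, hx]
  have hq : q x = q (‖x‖⁻¹ • x) * ‖x‖ ^ 2 := by
    rw [hhom, inv_pow]
    field_simp
  rw [hq]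
  exact ⟨mul_le_mul_of_nonneg_right (hmin hunit) (sq_nonneg _),
    mul_le_mul_of_nonneg_right (hmax hunit) (sq_nonneg _)⟩

end Norms

section DualVectors

theorem crs_comm (x y : DualVec) : crs x y = crs y x := by
  rw [crs, crs, real_inner_comm, real_inner_comm y.1, add_comm]

theorem crs_add_right (x y z : DualVec) : crs x (y + z) = crs x y + crs x z := by
  simp only [crs, Prod.fst_add, Prod.snd_add, inner_add_right]
  ring

theorem crs_smul_right (x y : DualVec) (r : ℝ) : crs x (r • y) = r * crs x y := by
  simp only [crs, Prod.smul_fst, Prod.smul_snd, inner_smul_right]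
  ring

theorem crs_neg_right (x y : DualVec) : crs x (-y) = -crs x y := by
  simpa using crs_smul_right x y (-1)

theorem crs_sub_right (x y z : DualVec) : crs x (y - z) = crs x y - crs x z := by
  rw [sub_eq_add_neg, crs_add_right, crs_neg_right, ← sub_eq_add_neg]

theorem crs_le (x y : DualVec) : crs x y ≤ 2 * ‖x‖ * ‖y‖ :=
  calc crs x y ≤ ‖x.1‖ * ‖y.2‖ + ‖x.2‖ * ‖y.1‖ :=
        add_le_add (real_inner_le_norm _ _) (real_inner_le_norm _ _)
    _ ≤ ‖x‖ * ‖y‖ + ‖x‖ * ‖y‖ := by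
        gcongr
        exacts [norm_fst_le x, norm_snd_le y, norm_snd_le x, norm_fst_le y]
    _ = 2 * ‖x‖ * ‖y‖ := by ring

theorem dualCross_self (x : DualVec) : dualCross x x = 0 := by
  ext i <;> fin_cases i <;> simp [dualCross, cross_apply] <;> ring

theorem dualCross_anticomm (x y : DualVec) : -dualCross x y = dualCross y x := by
  ext i <;> fin_cases i <;> simp [dualCross, cross_apply] <;> ring

theorem dualCross_add_left (x y z : DualVec) :
    dualCross (x + y) z = dualCross x z + dualCross y z := by
  ext i <;> fin_cases i <;> simp [dualCross, cross_apply] <;> ring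

theorem dualCross_add_right (x y z : DualVec) :
    dualCross x (y + z) = dualCross x y + dualCross x z := by
  rw [← dualCross_anticomm, dualCross_add_left, neg_add, dualCross_anticomm, dualCross_anticomm]

theorem crs_dualCross_rotate (x y z : DualVec) :
    crs x (dualCross y z) = crs y (dualCross z x) := by
  simp only [crs, dualCross, inner_vector, cross_apply, PiLp.add_apply,
    Matrix.cons_val]
  ring

theorem crs_dualCross_left_self (x y : DualVec) : crs x (dualCross x y) = 0 := by
  rw [crs_dualCross_rotate, crs_dualCross_rotate, dualCross_self]
  simp [crs]

end DualVectors

section Inertia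

variable {m : ℝ} {J : Matrix (Fin 3) (Fin 3) ℝ}

/-- The dual inertia operator as a continuous linear map. -/
def inertiaCLM (m : ℝ) (J : Matrix (Fin 3) (Fin 3) ℝ) : DualVec →L[ℝ] DualVec :=
  (m • ContinuousLinearMap.snd ℝ E3 E3).prod
    (Matrix.toEuclideanCLM (𝕜 := ℝ) J ∘L ContinuousLinearMap.fst ℝ E3 E3)

theorem inertia_snd (x : DualVec) :
    (inertia m J x).2 = Matrix.toEuclideanCLM (𝕜 := ℝ) J x.1 := rfl

theorem crs_inertia (x y : DualVec) :
    crs x (inertia m J y)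
      = inner ℝ x.1 (Matrix.toEuclideanCLM (𝕜 := ℝ) J y.1) + m * inner ℝ x.2 y.2 := by
  rw [crs, inertia_snd, inertia, inner_smul_right]

theorem crs_inertia_comm (hJ : J.IsHermitian) (x y : DualVec) :
    crs x (inertia m J y) = crs y (inertia m J x) := by
  have hsymm : inner ℝ (Matrix.toEuclideanCLM (𝕜 := ℝ) J y.1) x.1
      = inner ℝ y.1 (Matrix.toEuclideanCLM (𝕜 := ℝ) J x.1) :=
    Matrix.isSymmetric_toEuclideanLin_iff.2 hJ y.1 x.1
  rw [crs_inertia, crs_inertia, ← hsymm, real_inner_comm x.1, real_inner_comm x.2]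

theorem crs_inertia_self_pos (hm : 0 < m) (hJ : J.PosDef) {x : DualVec} (hx : x ≠ 0) :
    0 < crs x (inertia m J x) := by
  have hJx : inner ℝ x.1 (Matrix.toEuclideanCLM (𝕜 := ℝ) J x.1)
      = star x.1.ofLp ⬝ᵥ J.mulVec x.1.ofLp := by
    rw [EuclideanSpace.inner_eq_star_dotProduct, dotProduct_comm]
    rfl
  rw [crs_inertia, hJx, real_inner_self_eq_norm_sq]
  by_cases hx₁ : x.1 = 0
  · have hx₂ : x.2 ≠ 0 := fun h => hx (Prod.ext hx₁ h)
    simp only [hx₁, WithLp.ofLp_zero, star_zero, zero_dotProduct, zero_add]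
    positivity
  · have := hJ.dotProduct_mulVec_pos (x := x.1.ofLp) (by simpa using hx₁)
    positivity

/-- The kinetic energy of a rigid body with dual velocity `x`. -/
def kineticEnergy (m : ℝ) (J : Matrix (Fin 3) (Fin 3) ℝ) (x : DualVec) : ℝ :=
  1 / 2 * crs x (inertia m J x)

theorem contDiff_kineticEnergy : ContDiff ℝ 1 (kineticEnergy m J) := by
  have hM : ContDiff ℝ 1 (inertia m J) := (inertiaCLM m J).contDiff
  exact contDiff_const.mul ((contDiff_fst.inner ℝ hM.snd).add (contDiff_snd.inner ℝ hM.fst))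

theorem kineticEnergy_zero : kineticEnergy m J 0 = 0 := by simp [kineticEnergy, crs]

theorem hasDerivAt_kineticEnergy (hJ : J.IsHermitian) {x : ℝ → DualVec} {x' : DualVec} {t : ℝ}
    (hx : HasDerivAt x x' t) :
    HasDerivAt (fun τ => kineticEnergy m J (x τ)) (crs (x t) (inertia m J x')) t := by
  have hMx : HasDerivAt (fun τ => inertia m J (x τ)) (inertia m J x') t :=
    (inertiaCLM m J).hasFDerivAt.comp_hasDerivAt t hx
  have hfst : ∀ {y : ℝ → DualVec} {y' : DualVec}, HasDerivAt y y' t →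
      HasDerivAt (fun τ => (y τ).1) y'.1 t := fun hy =>
    (ContinuousLinearMap.fst ℝ E3 E3).hasFDerivAt.comp_hasDerivAt t hy
  have hsnd : ∀ {y : ℝ → DualVec} {y' : DualVec}, HasDerivAt y y' t →
      HasDerivAt (fun τ => (y τ).2) y'.2 t := fun hy =>
    (ContinuousLinearMap.snd ℝ E3 E3).hasFDerivAt.comp_hasDerivAt t hy
  refine ((((hfst hx).inner ℝ (hsnd hMx)).add ((hsnd hx).inner ℝ (hfst hMx))).const_mul
    (1 / 2)).congr_deriv ?_
  have hsymm : crs x' (inertia m J (x t)) = crs (x t) (inertia m J x') := crs_inertia_comm hJ _ _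
  simp only [crs] at hsymm ⊢
  linarith

theorem exists_kineticEnergy_bounds (hm : 0 < m) (hJ : J.PosDef) :
    ∃ c > 0, ∃ C, ∀ x,
      c * ‖x‖ ^ 2 ≤ kineticEnergy m J x ∧ kineticEnergy m J x ≤ C * ‖x‖ ^ 2 := by
  refine exists_norm_sq_bounds contDiff_kineticEnergy.continuous (fun r x => ?_) fun x hx =>
    mul_pos one_half_pos (crs_inertia_self_pos hm hJ hx)
  have hM : inertia m J (r • x) = r • inertia m J x := map_smul (inertiaCLM m J) r x
  rw [kineticEnergy, kineticEnergy, hM, crs_smul_right, crs_comm, crs_smul_right, crs_comm]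
  ring

/- All gyroscopic terms quadratic in `x` cancel: `x × M(x + y)` is orthogonal to `x`, and `y × M x`
compensates the rotation `y × x` of the error frame because `M` is symmetric. -/
theorem crs_inertia_rate (hJ : J.IsHermitian) {x y z α F : DualVec}
    (h : inertia m J α = -dualCross (x + y) (inertia m J (x + y)) + F) :
    crs x (inertia m J (α - (z + dualCross y x)))
      = crs x F - crs x (dualCross y (inertia m J y) + inertia m J z) := by
  have hM_add : ∀ a b, inertia m J (a + b) = inertia m J a + inertia m J b :=
    map_add (inertiaCLM m J)
  have hM_sub : ∀ a b, inertia m J (a - b) = inertia m J a - inertia m J b :=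
    map_sub (inertiaCLM m J)
  have hframe : crs x (inertia m J (dualCross y x)) = -crs x (dualCross y (inertia m J x)) := by
    rw [crs_inertia_comm hJ, crs_comm, crs_dualCross_rotate, crs_dualCross_rotate,
      ← crs_neg_right, dualCross_anticomm]
  rw [hM_sub, hM_add, h, crs_sub_right, crs_add_right, crs_add_right, crs_neg_right, hframe,
    dualCross_add_left, crs_add_right, crs_dualCross_left_self, hM_add, dualCross_add_right,
    crs_add_right, crs_add_right]
  ring

end Inertia

section Control

theorem mul_of_mem_sgnSet {v r : ℝ} (h : r ∈ SgnSet v) : v * r = |v| := by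
  rcases eq_or_ne v 0 with rfl | hv
  · simp
  · rw [SgnSet, if_neg hv, mem_singleton_iff] at h
    rcases lt_or_gt_of_ne hv with hv | hv
    · rw [h, Real.sign_of_neg hv, abs_of_neg hv, mul_neg_one]
    · rw [h, Real.sign_of_pos hv, abs_of_pos hv, mul_one]

theorem abs_le_one_of_mem_sgnSet {v r : ℝ} (h : r ∈ SgnSet v) : |r| ≤ 1 := by
  rcases eq_or_ne v 0 with rfl | hv
  · rw [SgnSet, if_pos rfl] at h
    exact abs_le.2 h
  · rw [SgnSet, if_neg hv, mem_singleton_iff] at h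
    rcases Real.sign_apply_eq v with hs | hs | hs <;> simp [h, hs]

theorem norm_le_three_of_abs_le_one {x : E3} (h : ∀ i, |x i| ≤ 1) : ‖x‖ ≤ 3 :=
  (norm_le_sum_abs x).trans <| by
    simpa using Finset.sum_le_card_nsmul Finset.univ _ _ fun i _ => h i

theorem norm_sgnSelection_le {σ x : DualVec} (h : IsSgnSelection σ x) : ‖σ‖ ≤ 3 :=
  max_le (norm_le_three_of_abs_le_one fun i => abs_le_one_of_mem_sgnSet (h.1 i))
    (norm_le_three_of_abs_le_one fun i => abs_le_one_of_mem_sgnSet (h.2 i))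

theorem crs_funcOfSgn {σ x : DualVec} (h : IsSgnSelection σ x) (y z : DualVec) :
    crs x (funcOfSgn σ y z) = (‖y.1‖ ^ 2 + ‖z.1‖ + 1) * ∑ i, |x.1 i|
      + (‖cross y.1 y.2 + z.2‖ + 1) * ∑ i, |x.2 i| := by
  have hinner : ∀ {v w : E3}, (∀ i, w i ∈ SgnSet (v i)) → inner ℝ v w = ∑ i, |v i| := by
    intro v w hvw
    rw [inner_vector, Fin.sum_univ_three, mul_of_mem_sgnSet (hvw 0), mul_of_mem_sgnSet (hvw 1),
      mul_of_mem_sgnSet (hvw 2)]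
  rw [crs, funcOfSgn, inner_smul_right, inner_smul_right, hinner h.1, hinner h.2]

theorem crs_func (x y z : DualVec) :
    crs x (func x y z) = (‖y.1‖ ^ 2 + ‖z.1‖ + 1) * ∑ i, |x.1 i|
      + (‖cross y.1 y.2 + z.2‖ + 1) * ∑ i, |x.2 i| :=
  crs_funcOfSgn (isSgnSelection_dualSgn x) y z

theorem le_crs_func (x y z : DualVec) :
    (‖y.1‖ ^ 2 + ‖z.1‖ + 1) * ‖x.1‖ + (‖cross y.1 y.2 + z.2‖ + 1) * ‖x.2‖
      ≤ crs x (func x y z) := by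
  rw [crs_func]
  gcongr <;> exact norm_le_sum_abs _

/-- The signal `crs(x, func(x, tr u, tr u'))` that drives the update of the estimate, for the pose
error `A`, the velocity error `x` and the desired velocity `u` with derivative `u'`. -/
def learningSignal (A : DualQuat) (u u' x : DualVec) : ℝ := crs x (func x (tr A u) (tr A u'))

theorem norm_le_learningSignal (A : DualQuat) (u u' x : DualVec) :
    ‖x‖ ≤ learningSignal A u u' x := by
  refine le_trans ?_ (le_crs_func x (tr A u) (tr A u'))
  have h₁ : ‖x.1‖ ≤ (‖(tr A u).1‖ ^ 2 + ‖(tr A u').1‖ + 1) * ‖x.1‖ :=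
    le_mul_of_one_le_left (norm_nonneg _) (le_add_of_nonneg_left (by positivity))
  have h₂ : ‖x.2‖ ≤ (‖cross (tr A u).1 (tr A u).2 + (tr A u').2‖ + 1) * ‖x.2‖ :=
    le_mul_of_one_le_left (norm_nonneg _) (le_add_of_nonneg_left (by positivity))
  exact max_le (h₁.trans (le_add_of_nonneg_right (by positivity)))
    (h₂.trans (le_add_of_nonneg_left (by positivity)))

theorem learningSignal_zero (A : DualQuat) (u u' : DualVec) : learningSignal A u u' 0 = 0 := by
  simp [learningSignal, crs]

theorem norm_tr_fst_le {A : DualQuat} (hA : ‖re A‖ = 1) (u : DualVec) : ‖(tr A u).1‖ ≤ ‖u‖ := by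
  rw [tr_fst]
  refine (norm_red_le _).trans ?_
  simpa [hA] using norm_fst_le u

theorem norm_tr_snd_le {A : DualQuat} (hA : ‖re A‖ = 1) (u : DualVec) :
    ‖(tr A u).2‖ ≤ (1 + 2 * ‖du A‖) * ‖u‖ := by
  rw [tr_snd]
  calc _ ≤ ‖star (re A) * aug u.1 * du A‖
        + (‖star (re A) * aug u.2 * re A‖ + ‖star (du A) * aug u.1 * re A‖) := by
        rw [add_mul]
        exact (norm_red_le _).trans ((norm_add_le _ _).trans (by gcongr; exact norm_add_le _ _))
    _ = ‖u.1‖ * ‖du A‖ + (‖u.2‖ + ‖du A‖ * ‖u.1‖) := by simp [hA]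
    _ ≤ ‖u‖ * ‖du A‖ + (‖u‖ + ‖du A‖ * ‖u‖) := by
        gcongr
        exacts [norm_fst_le u, norm_snd_le u, norm_fst_le u]
    _ = (1 + 2 * ‖du A‖) * ‖u‖ := by ring

theorem func_coeff_le {A : DualQuat} (hA : ‖re A‖ = 1) {u u' : DualVec} {W : ℝ}
    (hu : ‖u‖ ≤ W) (hu' : ‖u'‖ ≤ W) :
    ‖(tr A u).1‖ ^ 2 + ‖(tr A u').1‖ + 1 ≤ W ^ 2 + W + 1 ∧
      ‖cross (tr A u).1 (tr A u).2 + (tr A u').2‖ + 1 ≤ (W ^ 2 + W + 1) * (1 + 2 * ‖du A‖) := by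
  have hfst : ‖(tr A u).1‖ ≤ W := (norm_tr_fst_le hA u).trans hu
  have hfst' : ‖(tr A u').1‖ ≤ W := (norm_tr_fst_le hA u').trans hu'
  have hsnd : ‖(tr A u).2‖ ≤ (1 + 2 * ‖du A‖) * W := (norm_tr_snd_le hA u).trans (by gcongr)
  have hsnd' : ‖(tr A u').2‖ ≤ (1 + 2 * ‖du A‖) * W := (norm_tr_snd_le hA u').trans (by gcongr)
  refine ⟨by gcongr, ?_⟩
  calc ‖cross (tr A u).1 (tr A u).2 + (tr A u').2‖ + 1
      ≤ ‖(tr A u).1‖ * ‖(tr A u).2‖ + ‖(tr A u').2‖ + 1 := by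
        gcongr
        exact (norm_add_le _ _).trans (by gcongr; exact norm_cross_le _ _)
    _ ≤ W * ((1 + 2 * ‖du A‖) * W) + (1 + 2 * ‖du A‖) * W + (1 + 2 * ‖du A‖) := by
        have hW : 0 ≤ W := (norm_nonneg _).trans hu
        gcongr
        exact le_add_of_nonneg_right (by positivity)
    _ = (W ^ 2 + W + 1) * (1 + 2 * ‖du A‖) := by ring

theorem learningSignal_le {A : DualQuat} (hA : ‖re A‖ = 1) {u u' : DualVec} {W : ℝ}
    (hu : ‖u‖ ≤ W) (hu' : ‖u'‖ ≤ W) (x : DualVec) :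
    learningSignal A u u' x ≤ 6 * (W ^ 2 + W + 1) * (1 + 2 * ‖du A‖) * ‖x‖ := by
  obtain ⟨hcoeff₁, hcoeff₂⟩ := func_coeff_le hA hu hu'
  have hW : 0 ≤ W := (norm_nonneg _).trans hu
  have hone : 1 ≤ 1 + 2 * ‖du A‖ := le_add_of_nonneg_right (by positivity)
  have hsum : ∀ v : E3, ‖v‖ ≤ ‖x‖ → ∑ i, |v i| ≤ 3 * ‖x‖ := fun v hv =>
    (sum_abs_le_card_mul_norm v).trans (by simpa using hv)
  calc learningSignal A u u' x
      ≤ (W ^ 2 + W + 1) * (1 + 2 * ‖du A‖) * (3 * ‖x‖)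
        + (W ^ 2 + W + 1) * (1 + 2 * ‖du A‖) * (3 * ‖x‖) := by
        rw [learningSignal, crs_func]
        gcongr
        · exact hcoeff₁.trans (le_mul_of_one_le_right (by positivity) hone)
        · exact hsum _ (norm_fst_le x)
        · exact hsum _ (norm_snd_le x)
    _ = _ := by ring

/-- The proportional-derivative part of the control law, up to its sign. -/
def feedback (kp kd : ℝ) (A : DualQuat) (x : DualVec) : DualVec :=
  kd • exch x + kp • (red (star (re A) * du A), red (re A))

theorem control_eq (kp kd θ : ℝ) (σ : DualVec) (A : DualQuat) (x u u' : DualVec) :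
    control kp kd θ σ A x u u'
      = -(θ • funcOfSgn σ (tr A u) (tr A u') + feedback kp kd A x) := by
  ext i <;> simp [control, feedback, exch] <;> ring

theorem norm_feedback_le (kp kd : ℝ) {A : DualQuat} (hA : ‖re A‖ = 1) (x : DualVec) :
    ‖feedback kp kd A x‖ ≤ |kd| * ‖x‖ + |kp| * (1 + ‖du A‖) := by
  have hexch : ‖exch x‖ = ‖x‖ := max_comm _ _
  have hpose : ‖(red (star (re A) * du A), red (re A))‖ ≤ 1 + ‖du A‖ := by
    refine max_le ((norm_red_le _).trans ?_) ((norm_red_le _).trans ?_)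
    · simp [hA]
    · simp [hA]
  refine (norm_add_le _ _).trans ?_
  rw [norm_smul, norm_smul, Real.norm_eq_abs, Real.norm_eq_abs, hexch]
  gcongr

theorem norm_control_le {σ x : DualVec} (hσ : IsSgnSelection σ x) (kp kd θ : ℝ) {A : DualQuat}
    (hA : ‖re A‖ = 1) {u u' : DualVec} {W : ℝ} (hu : ‖u‖ ≤ W) (hu' : ‖u'‖ ≤ W) :
    ‖control kp kd θ σ A x u u'‖ ≤ |θ| * ((W ^ 2 + W + 1) * (1 + 2 * ‖du A‖) * 3)
      + (|kd| * ‖x‖ + |kp| * (1 + ‖du A‖)) := by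
  obtain ⟨hcoeff₁, hcoeff₂⟩ := func_coeff_le hA hu hu'
  have hW : 0 ≤ W := (norm_nonneg _).trans hu
  have hone : 1 ≤ 1 + 2 * ‖du A‖ := le_add_of_nonneg_right (by positivity)
  have hσ₃ := norm_sgnSelection_le hσ
  have hfunc : ‖funcOfSgn σ (tr A u) (tr A u')‖ ≤ (W ^ 2 + W + 1) * (1 + 2 * ‖du A‖) * 3 := by
    refine max_le ?_ ?_ <;> simp only [funcOfSgn, norm_smul]
    · rw [Real.norm_of_nonneg (by positivity)]
      gcongr
      exact (norm_snd_le σ).trans hσ₃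
    · rw [Real.norm_of_nonneg (by positivity)]
      gcongr
      · exact hcoeff₁.trans (le_mul_of_one_le_right (by positivity) hone)
      · exact (norm_fst_le σ).trans hσ₃
  rw [control_eq, norm_neg]
  refine (norm_add_le _ _).trans ?_
  rw [norm_smul, Real.norm_eq_abs]
  gcongr
  exact norm_feedback_le kp kd hA x

theorem dualCross_inertia_add_inertia {m : ℝ} (J : Matrix (Fin 3) (Fin 3) ℝ) (y z : DualVec) :
    dualCross y (inertia m J y) + inertia m J z
      = (m • (cross y.1 y.2 + z.2), cross y.1 (Matrix.toEuclideanCLM (𝕜 := ℝ) J y.1)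
          + Matrix.toEuclideanCLM (𝕜 := ℝ) J z.1) := by
  refine Prod.ext ?_ ?_
  · ext i
    fin_cases i <;> simp [dualCross, inertia, cross_apply] <;> ring
  · have hparallel : cross y.2 (m • y.2) = 0 := by
      ext i
      fin_cases i <;> simp [cross_apply] <;> ring
    rw [Prod.snd_add, dualCross, inertia_snd, inertia_snd, inertia, hparallel, add_zero]

theorem neg_crs_gyroscopic_le {m : ℝ} (hm : 0 ≤ m) (J : Matrix (Fin 3) (Fin 3) ℝ)
    (x y z : DualVec) :
    -crs x (dualCross y (inertia m J y) + inertia m J z)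
      ≤ (m + ‖Matrix.toEuclideanCLM (𝕜 := ℝ) J‖) * crs x (func x y z) := by
  rw [dualCross_inertia_add_inertia]
  set L := Matrix.toEuclideanCLM (𝕜 := ℝ) J
  have htorque : ‖cross y.1 (L y.1) + L z.1‖ ≤ ‖L‖ * (‖y.1‖ ^ 2 + ‖z.1‖) :=
    calc ‖cross y.1 (L y.1) + L z.1‖ ≤ ‖y.1‖ * (‖L‖ * ‖y.1‖) + ‖L‖ * ‖z.1‖ :=
          (norm_add_le _ _).trans (add_le_add ((norm_cross_le _ _).trans
            (by gcongr; exact L.le_opNorm _)) (L.le_opNorm _))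
      _ = ‖L‖ * (‖y.1‖ ^ 2 + ‖z.1‖) := by ring
  have hinner : ∀ v w : E3, -inner ℝ v w ≤ ‖v‖ * ‖w‖ := fun v w => by
    simpa using real_inner_le_norm v (-w)
  calc -crs x (m • (cross y.1 y.2 + z.2), cross y.1 (L y.1) + L z.1)
      = -inner ℝ x.1 (cross y.1 (L y.1) + L z.1)
        + m * -inner ℝ x.2 (cross y.1 y.2 + z.2) := by
        rw [crs, inner_smul_right]
        ring
    _ ≤ ‖x.1‖ * (‖L‖ * (‖y.1‖ ^ 2 + ‖z.1‖)) + m * (‖x.2‖ * ‖cross y.1 y.2 + z.2‖) := by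
        gcongr
        · exact (hinner _ _).trans (by gcongr)
        · exact hinner _ _
    _ ≤ ‖x.1‖ * ((m + ‖L‖) * (‖y.1‖ ^ 2 + ‖z.1‖ + 1))
        + (m + ‖L‖) * (‖x.2‖ * (‖cross y.1 y.2 + z.2‖ + 1)) := by
        gcongr ‖x.1‖ * (?_ * ?_) + ?_ * (_ * ?_)
        · exact le_add_of_nonneg_left hm
        · exact le_add_of_nonneg_right zero_le_one
        · exact le_add_of_nonneg_right (norm_nonneg _)
        · exact le_add_of_nonneg_right zero_le_one
    _ = (m + ‖L‖) * ((‖y.1‖ ^ 2 + ‖z.1‖ + 1) * ‖x.1‖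
        + (‖cross y.1 y.2 + z.2‖ + 1) * ‖x.2‖) := by ring
    _ ≤ (m + ‖L‖) * crs x (func x y z) := by
        gcongr
        exact le_crs_func x y z

theorem power_le {m kp kd θ β : ℝ} (hm : 0 ≤ m) {J : Matrix (Fin 3) (Fin 3) ℝ}
    (hJ : J.IsHermitian) {A : DualQuat} (hA : ‖re A‖ = 1) {σ x u u' α D : DualVec}
    (hσ : IsSgnSelection σ x) (hD : ‖D‖ ≤ β)
    (h : inertia m J α = -dualCross (x + tr A u) (inertia m J (x + tr A u))
      + (control kp kd θ σ A x u u' + D)) :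
    crs x (inertia m J (α - (tr A u' + dualCross (tr A u) x)))
      ≤ (m + ‖Matrix.toEuclideanCLM (𝕜 := ℝ) J‖ - θ) * learningSignal A u u' x
        + 2 * (|kd| * ‖x‖ + |kp| * (1 + ‖du A‖) + β) * ‖x‖ := by
  have hgyro := neg_crs_gyroscopic_le hm J x (tr A u) (tr A u')
  rw [← learningSignal] at hgyro
  have hfunc : crs x (funcOfSgn σ (tr A u) (tr A u')) = learningSignal A u u' x := by
    rw [learningSignal, crs_func, crs_funcOfSgn hσ]
  have hresidual : crs x (D - feedback kp kd A x)
      ≤ 2 * ‖x‖ * (β + (|kd| * ‖x‖ + |kp| * (1 + ‖du A‖))) :=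
    (crs_le _ _).trans (by
      gcongr
      exact (norm_sub_le _ _).trans (add_le_add hD (norm_feedback_le kp kd hA x)))
  have hforce : crs x (control kp kd θ σ A x u u' + D)
      = -(θ * learningSignal A u u' x) + crs x (D - feedback kp kd A x) := by
    rw [control_eq, crs_add_right, crs_neg_right, crs_add_right, crs_smul_right, hfunc,
      crs_sub_right]
    ring
  rw [crs_inertia_rate hJ h, hforce]
  linarith

end Control

section ErrorTrajectories

theorem two_mul_inner_du_rate (a b : ℍ[ℝ]) (x y : E3) :
    2 * inner ℝ b ((1 / 2 : ℝ) • (a * aug y + b * aug x)) = inner ℝ (red (star a * b)) y := by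
  rw [Quaternion.inner_def, inner_vector]
  simp [red]
  ring

theorem norm_sq_le_mul_energy {c n b E : ℝ} (hc : 0 < c) (hE : c * n ^ 2 ≤ E) :
    n ^ 2 + b ^ 2 + 1 ≤ (1 / c + 1) * (E + b ^ 2 + 1) := by
  have hn : n ^ 2 ≤ 1 / c * E := by rwa [one_div_mul_eq_div, le_div_iff₀' hc]
  have hE₀ : 0 ≤ E := (by positivity : 0 ≤ c * n ^ 2).trans hE
  have hb : 0 ≤ 1 / c * (b ^ 2 + 1) := by positivity
  linarith

theorem power_add_le_norm_sq {M K n b S θ kp kd β : ℝ} (hM : 0 ≤ M) (hK : 0 ≤ K) (hβ : 0 ≤ β)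
    (hθ : 0 ≤ θ) (hS₀ : 0 ≤ S) (hS : S ≤ 6 * K * (1 + 2 * b) * n) :
    (M - θ) * S + 2 * (|kd| * n + |kp| * (1 + b) + β) * n + b * n
      ≤ (12 * M * K + 2 * |kd| + 2 * |kp| + 2 * β + 1) * (n ^ 2 + b ^ 2 + 1) := by
  have hbn : b * n ≤ n ^ 2 + b ^ 2 + 1 := by nlinarith [sq_nonneg (b - n), sq_nonneg (b + n)]
  have hn : (1 + b) * n ≤ n ^ 2 + b ^ 2 + 1 := by
    nlinarith [sq_nonneg (n - 1), sq_nonneg (b - n), sq_nonneg b]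
  have hn' : n ≤ n ^ 2 + b ^ 2 + 1 := by nlinarith [sq_nonneg (n - 1), sq_nonneg b, sq_nonneg n]
  have hbn' : (1 + 2 * b) * n ≤ 2 * (n ^ 2 + b ^ 2 + 1) := by linarith
  calc (M - θ) * S + 2 * (|kd| * n + |kp| * (1 + b) + β) * n + b * n
      ≤ M * S + 2 * (|kd| * n + |kp| * (1 + b) + β) * n + b * n := by
        gcongr
        exact sub_le_self M hθ
    _ ≤ M * (6 * K * (1 + 2 * b) * n) + 2 * (|kd| * n + |kp| * (1 + b) + β) * n + b * n := by gcongr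
    _ = 6 * M * K * ((1 + 2 * b) * n) + 2 * |kd| * n ^ 2 + 2 * |kp| * ((1 + b) * n) + 2 * β * n
          + 1 * (b * n) := by ring
    _ ≤ 6 * M * K * (2 * (n ^ 2 + b ^ 2 + 1)) + 2 * |kd| * (n ^ 2 + b ^ 2 + 1)
          + 2 * |kp| * (n ^ 2 + b ^ 2 + 1) + 2 * β * (n ^ 2 + b ^ 2 + 1)
          + 1 * (n ^ 2 + b ^ 2 + 1) := by
        gcongr
        rw [add_assoc]
        exact le_add_of_nonneg_right (by positivity)
    _ = _ := by ring

/-- `A` and `x` are the pose and velocity errors on `[0, T]` of a closed-loop trajectory with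
estimate `θ`, where `u` is the desired velocity with derivative `u'`. The velocity of the body is
`x + tr u`, the disturbance is bounded by `β`, and the motion starts at the pose error `ς`. -/
structure IsErrorTrajectory (m : ℝ) (J : Matrix (Fin 3) (Fin 3) ℝ) (T kp kd W β ς : ℝ)
    (u u' : ℝ → DualVec) (θ : ℝ → ℝ) (A : ℝ → DualQuat) (x : ℝ → DualVec) : Prop where
  desired : ∀ t ∈ Icc 0 T, HasDerivWithinAt u (u' t) (Icc 0 T) t
  norm_desired_le : ∀ t ∈ Icc 0 T, ‖u t‖ ≤ W
  norm_desired_deriv_le : ∀ t ∈ Icc 0 T, ‖u' t‖ ≤ W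
  kinematics : ∀ t ∈ Icc 0 T,
    HasDerivWithinAt A ((1 / 2 : ℝ) • (A t * dualAug (x t))) (Icc 0 T) t
  norm_re : ∀ t ∈ Icc 0 T, ‖re (A t)‖ = 1
  absolutelyContinuous : AbsolutelyContinuousOnInterval (fun t => x t + tr (A t) (u t)) 0 T
  dynamics : ∀ᵐ t, t ∈ Icc 0 T → ∃ α σ D : DualVec,
    HasDerivAt (fun τ => x τ + tr (A τ) (u τ)) α t ∧ IsSgnSelection σ (x t) ∧ ‖D‖ ≤ β ∧
      inertia m J α = -dualCross (x t + tr (A t) (u t)) (inertia m J (x t + tr (A t) (u t)))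
        + (control kp kd (θ t) σ (A t) (x t) (u t) (u' t) + D)
  init_pose : A 0 = ς • (1 : DualQuat)
  init_velocity : x 0 = 0

namespace IsErrorTrajectory

variable {m : ℝ} {J : Matrix (Fin 3) (Fin 3) ℝ} {T kp kd W β ς : ℝ}
  {u u' : ℝ → DualVec} {θ : ℝ → ℝ} {A : ℝ → DualQuat} {x : ℝ → DualVec}

theorem hasDerivWithinAt_re (H : IsErrorTrajectory m J T kp kd W β ς u u' θ A x) {t : ℝ}
    (ht : t ∈ Icc 0 T) :
    HasDerivWithinAt (fun τ => re (A τ)) ((1 / 2 : ℝ) • (re (A t) * aug (x t).1)) (Icc 0 T) t :=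
  (reCLM.hasFDerivAt.comp_hasDerivWithinAt t (H.kinematics t ht)).congr_deriv <| by
    change re _ = _
    simp

theorem hasDerivWithinAt_du (H : IsErrorTrajectory m J T kp kd W β ς u u' θ A x) {t : ℝ}
    (ht : t ∈ Icc 0 T) :
    HasDerivWithinAt (fun τ => du (A τ))
      ((1 / 2 : ℝ) • (re (A t) * aug (x t).2 + du (A t) * aug (x t).1)) (Icc 0 T) t :=
  (duCLM.hasFDerivAt.comp_hasDerivWithinAt t (H.kinematics t ht)).congr_deriv <| by
    change du _ = _
    simp

theorem continuousOn_pose (H : IsErrorTrajectory m J T kp kd W β ς u u' θ A x) :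
    ContinuousOn A (Icc 0 T) := fun t ht => (H.kinematics t ht).continuousWithinAt

theorem continuousOn_velocity (hT : 0 ≤ T)
    (H : IsErrorTrajectory m J T kp kd W β ς u u' θ A x) : ContinuousOn x (Icc 0 T) := by
  have hω := H.absolutelyContinuous.continuousOn
  rw [uIcc_of_le hT] at hω
  have htr : ContinuousOn (fun t => tr (A t) (u t)) (Icc 0 T) := fun t ht =>
    (hasDerivWithinAt_tr (H.kinematics t ht) (H.desired t ht)).continuousWithinAt
  have hx : x = (fun t => x t + tr (A t) (u t)) - fun t => tr (A t) (u t) :=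
    (add_sub_cancel_right x _).symm
  rw [hx]
  exact hω.sub htr

theorem absolutelyContinuous_pose (hT : 0 ≤ T)
    (H : IsErrorTrajectory m J T kp kd W β ς u u' θ A x) :
    AbsolutelyContinuousOnInterval A 0 T := by
  have hx : ContinuousOn (fun t => dualAug (x t)) (Icc 0 T) :=
    dualAugCLM.continuous.comp_continuousOn (H.continuousOn_velocity hT)
  have hA' : ContinuousOn (fun t => (1 / 2 : ℝ) • (A t * dualAug (x t))) (Icc 0 T) :=
    (H.continuousOn_pose.mul hx).const_smul (1 / 2 : ℝ)
  obtain ⟨C, hC⟩ := isCompact_Icc.exists_bound_of_continuousOn hA'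
  exact absolutelyContinuous_of_hasDerivWithinAt hT H.kinematics hC

theorem absolutelyContinuous_velocity (hT : 0 ≤ T)
    (H : IsErrorTrajectory m J T kp kd W β ς u u' θ A x) :
    AbsolutelyContinuousOnInterval x 0 T := by
  have hu := absolutelyContinuous_of_hasDerivWithinAt hT H.desired H.norm_desired_deriv_le
  have htr := absolutelyContinuous_comp_of_locallyLipschitz contDiff_tr.locallyLipschitz
    (absolutelyContinuous_prodMk (H.absolutelyContinuous_pose hT) hu)
  have hx : x = (fun t => x t + tr (A t) (u t)) - fun t => tr (A t) (u t) :=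
    (add_sub_cancel_right x _).symm
  rw [hx]
  exact H.absolutelyContinuous.sub htr

theorem absolutelyContinuous_kineticEnergy (hT : 0 ≤ T)
    (H : IsErrorTrajectory m J T kp kd W β ς u u' θ A x) :
    AbsolutelyContinuousOnInterval (fun t => kineticEnergy m J (x t)) 0 T :=
  absolutelyContinuous_comp_of_locallyLipschitz contDiff_kineticEnergy.locallyLipschitz
    (H.absolutelyContinuous_velocity hT)

theorem absolutelyContinuous_norm_sq_du (hT : 0 ≤ T)
    (H : IsErrorTrajectory m J T kp kd W β ς u u' θ A x) :
    AbsolutelyContinuousOnInterval (fun t => ‖du (A t)‖ ^ 2) 0 T :=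
  absolutelyContinuous_comp_of_locallyLipschitz (duCLM.contDiff.norm_sq ℝ).locallyLipschitz
    (H.absolutelyContinuous_pose hT)

theorem ae_hasDerivAt_kineticEnergy (hm : 0 ≤ m) (hJ : J.IsHermitian)
    (H : IsErrorTrajectory m J T kp kd W β ς u u' θ A x) :
    ∀ᵐ t, t ∈ Icc 0 T → ∃ v, HasDerivAt (fun τ => kineticEnergy m J (x τ)) v t ∧
      v ≤ (m + ‖Matrix.toEuclideanCLM (𝕜 := ℝ) J‖ - θ t) * learningSignal (A t) (u t) (u' t) (x t)
        + 2 * (|kd| * ‖x t‖ + |kp| * (1 + ‖du (A t)‖) + β) * ‖x t‖ := by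
  filter_upwards [H.dynamics, ae_Icc_mem_nhds 0 T] with t hdyn hnhds ht
  obtain ⟨α, σ, D, hω, hσ, hD, hnewton⟩ := hdyn ht
  have htr := hasDerivWithinAt_tr (H.kinematics t ht) (H.desired t ht)
  have hx : HasDerivAt x (α - (tr (A t) (u' t) + dualCross (tr (A t) (u t)) (x t))) t := by
    refine (hω.sub (htr.hasDerivAt (hnhds ht))).congr_of_eventuallyEq (.of_forall fun τ => ?_)
    exact (add_sub_cancel_right (x τ) _).symm
  exact ⟨_, hasDerivAt_kineticEnergy hJ hx, power_le hm hJ (H.norm_re t ht) hσ hD hnewton⟩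

theorem ae_hasDerivAt_norm_sq_du (H : IsErrorTrajectory m J T kp kd W β ς u u' θ A x) :
    ∀ᵐ t, t ∈ Icc 0 T → ∃ v, HasDerivAt (fun τ => ‖du (A τ)‖ ^ 2) v t ∧
      v ≤ ‖du (A t)‖ * ‖x t‖ := by
  filter_upwards [ae_Icc_mem_nhds 0 T] with t hnhds ht
  refine ⟨_, ((H.hasDerivWithinAt_du ht).hasDerivAt (hnhds ht)).norm_sq, ?_⟩
  rw [two_mul_inner_du_rate]
  refine (real_inner_le_norm _ _).trans ?_
  gcongr
  · exact (norm_red_le _).trans_eq (by simp [H.norm_re t ht])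
  · exact norm_snd_le _

theorem ae_hasDerivAt_energy (hm : 0 ≤ m) (hJ : J.IsHermitian) (hβ : 0 ≤ β)
    (H : IsErrorTrajectory m J T kp kd W β ς u u' θ A x) (hθ : ∀ t ∈ Icc 0 T, 0 ≤ θ t) :
    ∀ᵐ t, t ∈ Icc 0 T → ∃ v,
      HasDerivAt (fun τ => kineticEnergy m J (x τ) + ‖du (A τ)‖ ^ 2 + 1) v t ∧
        v ≤ (12 * (m + ‖Matrix.toEuclideanCLM (𝕜 := ℝ) J‖) * (W ^ 2 + W + 1)
          + 2 * |kd| + 2 * |kp| + 2 * β + 1) * (‖x t‖ ^ 2 + ‖du (A t)‖ ^ 2 + 1) := by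
  filter_upwards [H.ae_hasDerivAt_kineticEnergy hm hJ, H.ae_hasDerivAt_norm_sq_du]
    with t hkin hdu ht
  obtain ⟨v, hv, hpower⟩ := hkin ht
  obtain ⟨w, hw, hdrift⟩ := hdu ht
  refine ⟨v + w, (hv.add hw).add_const 1, (add_le_add hpower hdrift).trans ?_⟩
  have hW : 0 ≤ W := (norm_nonneg _).trans (H.norm_desired_le t ht)
  exact power_add_le_norm_sq (by positivity) (by positivity) hβ (hθ t ht)
    ((norm_nonneg _).trans (norm_le_learningSignal ..))
    (learningSignal_le (H.norm_re t ht) (H.norm_desired_le t ht) (H.norm_desired_deriv_le t ht) _)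

theorem exists_bound_of_nonneg (hm : 0 < m) (hJ : J.PosDef) (hT : 0 ≤ T) (hβ : 0 ≤ β)
    (kp kd W : ℝ) :
    ∃ D, ∀ ς u u' θ A x, IsErrorTrajectory m J T kp kd W β ς u u' θ A x →
      (∀ t ∈ Icc 0 T, 0 ≤ θ t) → ∀ t ∈ Icc 0 T, ‖x t‖ ≤ D ∧ ‖du (A t)‖ ≤ D := by
  obtain ⟨c, hc, C, hbounds⟩ := exists_kineticEnergy_bounds hm hJ
  let R := 12 * (m + ‖Matrix.toEuclideanCLM (𝕜 := ℝ) J‖) * (W ^ 2 + W + 1)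
    + 2 * |kd| + 2 * |kp| + 2 * β + 1
  refine ⟨√((1 / c + 1) * Real.exp (R * (1 / c + 1) * T)), fun ς u u' θ A x H hθ t ht => ?_⟩
  have hW : 0 ≤ W := (norm_nonneg _).trans (H.norm_desired_le t ht)
  have hcoercive (τ : ℝ) := norm_sq_le_mul_energy (b := ‖du (A τ)‖) hc (hbounds (x τ)).1
  have hR : 0 ≤ R := by positivity
  let V : ℝ → ℝ := fun τ => kineticEnergy m J (x τ) + ‖du (A τ)‖ ^ 2 + 1
  have hV : AbsolutelyContinuousOnInterval V 0 t :=
    (((H.absolutelyContinuous_kineticEnergy hT).add (H.absolutelyContinuous_norm_sq_du hT)).add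
      (contDiffOn_const (c := (1 : ℝ))).absolutelyContinuousOnInterval).mono
      (by simpa only [uIcc_of_le ht.1, uIcc_of_le hT] using Icc_subset_Icc_right ht.2)
  have hV₀ : V 0 = 1 := by simp [V, H.init_velocity, H.init_pose, kineticEnergy_zero]
  have hVt : V t ≤ Real.exp (R * (1 / c + 1) * T) := by
    have hgronwall := le_mul_exp_of_ae_hasDerivAt_le (C := R * (1 / c + 1)) ht.1 hV <| by
      filter_upwards [H.ae_hasDerivAt_energy hm.le hJ.1 hβ hθ] with τ hrate hτ
      obtain ⟨v, hv, hvR⟩ := hrate ⟨hτ.1.le, hτ.2.trans ht.2⟩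
      refine ⟨v, hv, hvR.trans ?_⟩
      rw [mul_assoc R]
      exact mul_le_mul_of_nonneg_left (hcoercive τ) hR
    rw [hV₀, one_mul, sub_zero] at hgronwall
    exact hgronwall.trans (by gcongr; exact ht.2)
  have hsq := (hcoercive t).trans (mul_le_mul_of_nonneg_left hVt (by positivity))
  constructor <;> refine Real.le_sqrt_of_sq_le (le_trans ?_ hsq)
  · nlinarith [sq_nonneg ‖du (A t)‖]
  · nlinarith [sq_nonneg ‖x t‖]

theorem kineticEnergy_le_of_le (hm : 0 ≤ m) (hJ : J.IsHermitian) (hT : 0 ≤ T) (hβ : 0 ≤ β) {D : ℝ}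
    (H : IsErrorTrajectory m J T kp kd W β ς u u' θ A x)
    (hD : ∀ t ∈ Icc 0 T, ‖x t‖ ≤ D ∧ ‖du (A t)‖ ≤ D) {a b : ℝ} (ha : a ∈ Icc 0 T)
    (hb : b ∈ Icc a T)
    (hθ : ∀ t ∈ Ioc a b, m + ‖Matrix.toEuclideanCLM (𝕜 := ℝ) J‖
      + 2 * (|kd| * D + |kp| * (1 + D) + β) ≤ θ t) :
    kineticEnergy m J (x b) ≤ kineticEnergy m J (x a) := by
  have hsub : Icc a b ⊆ Icc 0 T := Icc_subset_Icc ha.1 hb.2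
  refine le_of_ae_hasDerivAt_nonpos (V := fun t => kineticEnergy m J (x t)) hb.1
    ((H.absolutelyContinuous_kineticEnergy hT).mono (by rwa [uIcc_of_le hb.1, uIcc_of_le hT])) ?_
  filter_upwards [H.ae_hasDerivAt_kineticEnergy hm hJ] with t hrate hab
  have ht := hsub (Ioc_subset_Icc_self hab)
  obtain ⟨v, hv, hpower⟩ := hrate ht
  obtain ⟨hDx, hDdu⟩ := hD t ht
  have hD₀ : 0 ≤ D := (norm_nonneg _).trans hDx
  have hsignal := norm_le_learningSignal (A t) (u t) (u' t) (x t)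
  have hresidual : 2 * (|kd| * ‖x t‖ + |kp| * (1 + ‖du (A t)‖) + β) * ‖x t‖
      ≤ 2 * (|kd| * D + |kp| * (1 + D) + β) * learningSignal (A t) (u t) (u' t) (x t) := by
    gcongr
  have hgain := mul_le_mul_of_nonneg_right (hθ t hab) ((norm_nonneg _).trans hsignal)
  exact ⟨v, hv, by linarith⟩

theorem poseErr_le_integral (hT : 0 ≤ T) (H : IsErrorTrajectory m J T kp kd W β ς u u' θ A x)
    {D : ℝ} (hD : ∀ t ∈ Icc 0 T, ‖du (A t)‖ ≤ D) {t : ℝ} (ht : t ∈ Icc 0 T) :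
    ‖re (A t) - ς • 1‖ ≤ ∫ τ in (0)..t, ‖x τ‖ ∧
      ‖du (A t)‖ ≤ (1 + D) * ∫ τ in (0)..t, ‖x τ‖ := by
  have hsub : Icc 0 t ⊆ Icc 0 T := Icc_subset_Icc_right ht.2
  have hx := (H.continuousOn_velocity hT).mono hsub
  have hA := H.continuousOn_pose.mono hsub
  have hre : ContinuousOn (fun τ => re (A τ)) (Icc 0 t) := reCLM.continuous.comp_continuousOn hA
  have hdu : ContinuousOn (fun τ => du (A τ)) (Icc 0 t) := duCLM.continuous.comp_continuousOn hA
  have haug₁ : ContinuousOn (fun τ => aug (x τ).1) (Icc 0 t) :=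
    augCLM.continuous.comp_continuousOn hx.fst
  have haug₂ : ContinuousOn (fun τ => aug (x τ).2) (Icc 0 t) :=
    augCLM.continuous.comp_continuousOn hx.snd
  have hhalf (a : ℍ[ℝ]) : ‖(1 / 2 : ℝ) • a‖ ≤ ‖a‖ := by
    rw [norm_smul]
    norm_num
    linarith [norm_nonneg a]
  constructor
  · have h := norm_sub_le_integral (C := 1) ht.1
      (fun τ hτ => (H.hasDerivWithinAt_re (hsub hτ)).mono hsub)
      ((hre.mul haug₁).const_smul (1 / 2 : ℝ)) hx.norm fun τ hτ => (hhalf _).trans <| by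
        simpa [H.norm_re τ (hsub hτ)] using norm_fst_le (x τ)
    simpa [H.init_pose] using h
  · have h := norm_sub_le_integral (C := 1 + D) ht.1
      (fun τ hτ => (H.hasDerivWithinAt_du (hsub hτ)).mono hsub)
      (((hre.mul haug₂).add (hdu.mul haug₁)).const_smul (1 / 2 : ℝ)) hx.norm fun τ hτ => by
        refine (hhalf _).trans ((norm_add_le _ _).trans ?_)
        have hD₀ : 0 ≤ D := (norm_nonneg _).trans (hD τ (hsub hτ))
        rw [norm_mul, norm_mul, H.norm_re τ (hsub hτ), norm_aug, norm_aug, add_mul]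
        gcongr
        exacts [norm_snd_le (x τ), hD τ (hsub hτ), norm_fst_le (x τ)]
    simpa [H.init_pose] using h

theorem learningSignal_le_of_kineticEnergy_le {c C D : ℝ} (hc : 0 < c)
    (hbounds : ∀ y, c * ‖y‖ ^ 2 ≤ kineticEnergy m J y ∧ kineticEnergy m J y ≤ C * ‖y‖ ^ 2)
    (H : IsErrorTrajectory m J T kp kd W β ς u u' θ A x)
    (hD : ∀ t ∈ Icc 0 T, ‖x t‖ ≤ D ∧ ‖du (A t)‖ ≤ D) {a b : ℝ} (hb : b ∈ Icc 0 T)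
    (hle : kineticEnergy m J (x b) ≤ kineticEnergy m J (x a)) :
    learningSignal (A b) (u b) (u' b) (x b)
      ≤ 6 * (W ^ 2 + W + 1) * (1 + 2 * D) * √(C / c)
        * learningSignal (A a) (u a) (u' a) (x a) := by
  have hW : 0 ≤ W := (norm_nonneg _).trans (H.norm_desired_le b hb)
  have hD₀ : 0 ≤ D := (norm_nonneg _).trans (hD b hb).1
  have hx : ‖x b‖ ≤ √(C / c) * ‖x a‖ := by
    rw [← Real.sqrt_sq (norm_nonneg (x a)), ← Real.sqrt_mul' _ (sq_nonneg _)]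
    refine Real.le_sqrt_of_sq_le ?_
    rw [div_mul_eq_mul_div, le_div_iff₀' hc]
    exact (hbounds (x b)).1.trans (hle.trans (hbounds (x a)).2)
  calc learningSignal (A b) (u b) (u' b) (x b)
      ≤ 6 * (W ^ 2 + W + 1) * (1 + 2 * ‖du (A b)‖) * ‖x b‖ :=
        learningSignal_le (H.norm_re b hb) (H.norm_desired_le b hb) (H.norm_desired_deriv_le b hb) _
    _ ≤ 6 * (W ^ 2 + W + 1) * (1 + 2 * D) * (√(C / c) * ‖x a‖) := by
        gcongr
        exact (hD b hb).2
    _ = 6 * (W ^ 2 + W + 1) * (1 + 2 * D) * √(C / c) * ‖x a‖ := by ring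
    _ ≤ _ := by
        gcongr
        exact norm_le_learningSignal ..

end IsErrorTrajectory

section Iterations

variable {m : ℝ} {J : Matrix (Fin 3) (Fin 3) ℝ} {T kp kd W β : ℝ} {ς : ℕ → ℝ}
  {u u' : ℝ → DualVec} {θ : ℕ → ℝ → ℝ} {A : ℕ → ℝ → DualQuat} {x : ℕ → ℝ → DualVec}

theorem exists_bound_of_isLearningUpdate {s : ℕ} {h : ℕ → ℝ} {kc kl kθ : ℝ} (hm : 0 < m)
    (hJ : J.PosDef) (hβ : 0 ≤ β) (hs : 1 ≤ s) (h₀ : h 0 = 0) (hh : StrictMonoOn h (Iic s))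
    (hkc : 0 ≤ kc) (hkl : 0 < kl) (hkθ : 0 < kθ)
    (H : ∀ k, IsErrorTrajectory m J (h s) kp kd W β (ς k) u u' (θ k) (A k) (x k))
    (hlearn : IsLearningUpdate kc kl kθ (Icc 0 (h s)) (segment s h) θ
      fun k t => learningSignal (A k t) (u t) (u' t) (x k t)) :
    ∃ B, ∀ t ∈ Icc 0 (h s), ∀ n, ∑ k ∈ Finset.range n, ‖x k t‖ ≤ B ∧ ‖x n t‖ ≤ B ∧
      ‖du (A n t)‖ ≤ B ∧ |θ n t| ≤ B := by
  have hT : 0 ≤ h s := h₀ ▸ hh.monotoneOn (Nat.zero_le s) self_mem_Iic (Nat.zero_le s)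
  have hθ (k : ℕ) : ∀ t ∈ Icc 0 (h s), 0 ≤ θ k t := fun t => hlearn.nonneg hkl.le hkθ.le k
  obtain ⟨D, hD⟩ := IsErrorTrajectory.exists_bound_of_nonneg hm hJ hT hβ kp kd W
  replace hD (k : ℕ) := hD _ _ _ _ _ _ (H k) (hθ k)
  obtain ⟨c, hc, C, hbounds⟩ := exists_kineticEnergy_bounds hm hJ
  have hD₀ : 0 ≤ D := (norm_nonneg _).trans (hD 0 0 ⟨le_rfl, hT⟩).1
  have hW : 0 ≤ W := (norm_nonneg _).trans ((H 0).norm_desired_le 0 ⟨le_rfl, hT⟩)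
  rw [← h₀] at hlearn
  obtain ⟨B, hB⟩ := hlearn.exists_bound hh hs hkc hkl hkθ
    (Θ := m + ‖Matrix.toEuclideanCLM (𝕜 := ℝ) J‖ + 2 * (|kd| * D + |kp| * (1 + D) + β))
    (C := 6 * (W ^ 2 + W + 1) * (1 + 2 * D) * √(C / c))
    (G := 6 * (W ^ 2 + W + 1) * (1 + 2 * D) * (D + 1))
    (by positivity) (by positivity) (by positivity)
    (fun k t ht => by
      rw [h₀] at ht
      refine (learningSignal_le ((H k).norm_re t ht) ((H k).norm_desired_le t ht)
        ((H k).norm_desired_deriv_le t ht) _).trans ?_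
      gcongr
      exacts [(hD k t ht).2, (hD k t ht).1.trans (le_add_of_nonneg_right zero_le_one)])
    (fun k => by simp only [h₀, (H k).init_velocity, learningSignal_zero])
    (fun k a ha b hb hthreshold => by
      rw [h₀] at ha
      exact (H k).learningSignal_le_of_kineticEnergy_le hc hbounds (hD k) ⟨ha.1.trans hb.1, hb.2⟩
        ((H k).kineticEnergy_le_of_le hm.le hJ.1 hT hβ (hD k) ha hb hthreshold))
  rw [h₀] at hB
  refine ⟨max B D, fun t ht n => ⟨?_, le_max_of_le_right (hD n t ht).1,
    le_max_of_le_right (hD n t ht).2, ?_⟩⟩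
  · exact le_max_of_le_left ((Finset.sum_le_sum fun k _ => norm_le_learningSignal ..).trans
      (hB t ht n).1)
  · rw [abs_of_nonneg (hθ n t ht)]
    exact le_max_of_le_left (hB t ht n).2

theorem tendsto_poseErr_of_sum_le {B D : ℝ}
    (H : ∀ k, IsErrorTrajectory m J T kp kd W β (ς k) u u' (θ k) (A k) (x k))
    (hB : ∀ t ∈ Icc 0 T, ∀ n, ∑ k ∈ Finset.range n, ‖x k t‖ ≤ B)
    (hD : ∀ k, ∀ t ∈ Icc 0 T, ‖du (A k t)‖ ≤ D) {t : ℝ} (ht : t ∈ Icc 0 T) :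
    Tendsto (fun k => ‖re (A k t) - ς k • 1‖) atTop (nhds 0) ∧
      Tendsto (fun k => ‖du (A k t)‖) atTop (nhds 0) := by
  have hT : 0 ≤ T := ht.1.trans ht.2
  have hsub : Icc 0 t ⊆ Icc 0 T := Icc_subset_Icc_right ht.2
  have hint : Tendsto (fun k => ∫ τ in (0)..t, ‖x k τ‖) atTop (nhds 0) :=
    tendsto_integral_of_sum_le ht.1 (fun k => (((H k).continuousOn_velocity hT).mono hsub).norm)
      (fun k τ _ => norm_nonneg (x k τ)) fun τ hτ => hB τ (hsub hτ)
  have hle (k : ℕ) := (H k).poseErr_le_integral hT (hD k) ht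
  constructor
  · exact squeeze_zero (fun k => norm_nonneg _) (fun k => (hle k).1) hint
  · exact squeeze_zero (fun k => norm_nonneg _) (fun k => (hle k).2)
      (by simpa only [mul_zero] using hint.const_mul (1 + D))

end Iterations

end ErrorTrajectories

section Poses

theorem norm_red_le_norm_sub (a : ℍ[ℝ]) (r : ℝ) : ‖red a‖ ≤ ‖a - r • 1‖ := by
  have hred : red a = red (a - r • 1) := by
    ext i
    fin_cases i <;> simp [red]
  exact hred ▸ norm_red_le _

theorem norm_attErr_le (Qd Q : ℍ[ℝ]) (Pd P : E3) (r : ℝ) :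
    ‖attErr Qd Q‖ ≤ ‖re (poseErr (pose Qd Pd) (pose Q P)) - r • 1‖ := by
  simpa [attErr, poseErr, pose] using norm_red_le_norm_sub (star Qd * Q) r

theorem norm_re_poseErr {Qd Q : ℍ[ℝ]} (hQd : ‖Qd‖ = 1) (hQ : ‖Q‖ = 1) (Pd P : E3) :
    ‖re (poseErr (pose Qd Pd) (pose Q P))‖ = 1 := by
  simp [poseErr, pose, hQd, hQ]

theorem du_poseErr (Qd Q : ℍ[ℝ]) (Pd P : E3) :
    du (poseErr (pose Qd Pd) (pose Q P))
      = (1 / 2 : ℝ) • (star Qd * Q * aug P - aug Pd * (star Qd * Q)) := by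
  simp only [poseErr, pose, du_mul, re_conj, du_conj, re_mkDQ, du_mkDQ, Quaternion.star_smul,
    star_mul, star_aug, mul_smul_comm, smul_mul_assoc, neg_mul, smul_sub, smul_neg, mul_assoc]
  abel

theorem norm_posErr_le {Qd Q : ℍ[ℝ]} (hQd : ‖Qd‖ = 1) (hQ : ‖Q‖ = 1) (Pd P : E3) :
    ‖posErr Qd Pd Q P‖ ≤ 2 * ‖du (poseErr (pose Qd Pd) (pose Q P))‖ := by
  have hunit : star (star Qd * Q) * (star Qd * Q) = 1 := by
    rw [Quaternion.star_mul_self, Quaternion.normSq_eq_norm_mul_self, norm_mul, norm_star, hQd, hQ]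
    simp
  have haug : red (aug P) = P := by
    ext i
    fin_cases i <;> simp [red]
  have hpos : posErr Qd Pd Q P
      = red ((2 : ℝ) • (star (star Qd * Q) * du (poseErr (pose Qd Pd) (pose Q P)))) := by
    rw [du_poseErr, posErr]
    generalize star Qd * Q = a at hunit
    rw [mul_smul_comm, smul_smul, mul_one_div_cancel two_ne_zero, one_smul, mul_sub, ← mul_assoc,
      ← mul_assoc, hunit, one_mul]
    exact (congrArg (· - _) haug).symm.trans (map_sub redCLM _ _).symm
  rw [hpos]
  exact (norm_red_le _).trans_eq (by simp [norm_smul, hQd, hQ])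

theorem tendsto_smul_of_tendsto_poseErr {A : DualQuat} (hA : A * conj A = 1) {B : ℕ → DualQuat}
    {ς : ℕ → ℝ} (hς : ∀ k, ς k = 1 ∨ ς k = -1)
    (hre : Tendsto (fun k => ‖re (poseErr A (B k)) - ς k • 1‖) atTop (nhds 0))
    (hdu : Tendsto (fun k => ‖du (poseErr A (B k))‖) atTop (nhds 0)) :
    Tendsto (fun k => ς k • B k) atTop (nhds A) := by
  have habs (k : ℕ) : ‖ς k‖ = 1 := by rcases hς k with h | h <;> simp [h]
  have hsq (k : ℕ) : ς k * ς k = 1 := by rcases hς k with h | h <;> simp [h]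
  have hre' : Tendsto (fun k => ς k • re (poseErr A (B k))) atTop (nhds 1) := by
    refine tendsto_iff_norm_sub_tendsto_zero.2 (hre.congr fun k => ?_)
    rw [← one_mul ‖_‖, ← habs k, ← norm_smul, smul_sub, smul_smul, hsq, one_smul]
  have hdu' : Tendsto (fun k => ς k • du (poseErr A (B k))) atTop (nhds 0) := by
    refine tendsto_zero_iff_norm_tendsto_zero.2 (hdu.congr fun k => ?_)
    rw [norm_smul, habs, one_mul]
  have hone : mkDQCLM (1, 0) = 1 := dualQuat_ext (re_mkDQ _ _) (du_mkDQ _ _)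
  have hlim := ((mkDQCLM.continuous.tendsto (1, 0)).comp (hre'.prodMk_nhds hdu')).const_mul A
  rw [hone, mul_one] at hlim
  refine hlim.congr fun k => ?_
  have hsmul : mkDQCLM (ς k • re (poseErr A (B k)), ς k • du (poseErr A (B k)))
      = ς k • poseErr A (B k) := dualQuat_ext (re_mkDQ _ _) (du_mkDQ _ _)
  rw [Function.comp_apply, hsmul, dualQuat_mul_smul, poseErr, ← mul_assoc, hA, one_mul]

theorem tendsto_tracking_of_tendsto_poseErr {Qd : ℍ[ℝ]} (hQd : ‖Qd‖ = 1) {Pd : E3}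
    {Q : ℕ → ℍ[ℝ]} (hQ : ∀ k, ‖Q k‖ = 1) {P : ℕ → E3} {ς : ℕ → ℝ} (hς : ∀ k, ς k = 1 ∨ ς k = -1)
    (hre : Tendsto (fun k => ‖re (poseErr (pose Qd Pd) (pose (Q k) (P k))) - ς k • 1‖)
      atTop (nhds 0))
    (hdu : Tendsto (fun k => ‖du (poseErr (pose Qd Pd) (pose (Q k) (P k)))‖) atTop (nhds 0)) :
    Tendsto (fun k => ‖posErr Qd Pd (Q k) (P k)‖) atTop (nhds 0) ∧
      Tendsto (fun k => ‖attErr Qd (Q k)‖) atTop (nhds 0) ∧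
      Tendsto (fun k => ς k • pose (Q k) (P k)) atTop (nhds (pose Qd Pd)) :=
  ⟨squeeze_zero (fun k => norm_nonneg _) (fun k => norm_posErr_le hQd (hQ k) Pd (P k))
      (by simpa only [mul_zero] using hdu.const_mul 2),
    squeeze_zero (fun k => norm_nonneg _) (fun k => norm_attErr_le Qd (Q k) Pd (P k) (ς k)) hre,
    tendsto_smul_of_tendsto_poseErr (pose_mul_conj hQd Pd) hς hre hdu⟩

end Poses

section ClosedLoop

theorem isErrorTrajectory_of_closedLoop {m : ℝ} {J : Matrix (Fin 3) (Fin 3) ℝ}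
    {T kp kd W β ς : ℝ} {Qd Q : ℝ → ℍ[ℝ]} {Pd P : ℝ → E3} {u u' ω x σ f D : ℝ → DualVec}
    {A : ℝ → DualQuat} {θ : ℝ → ℝ} (hQd : ∀ t ∈ Icc 0 T, ‖Qd t‖ = 1)
    (hQ : ∀ t ∈ Icc 0 T, ‖Q t‖ = 1)
    (hu : ∀ t ∈ Icc 0 T, HasDerivWithinAt u (u' t) (Icc 0 T) t)
    (hW : ∀ t ∈ Icc 0 T, ‖u t‖ ≤ W) (hW' : ∀ t ∈ Icc 0 T, ‖u' t‖ ≤ W)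
    (hkind : ∀ t ∈ Icc 0 T, HasDerivWithinAt (fun τ => pose (Qd τ) (Pd τ))
      ((1 / 2 : ℝ) • (pose (Qd t) (Pd t) * dualAug (u t))) (Icc 0 T) t)
    (hkin : ∀ t ∈ Icc 0 T, HasDerivWithinAt (fun τ => pose (Q τ) (P τ))
      ((1 / 2 : ℝ) • (pose (Q t) (P t) * dualAug (ω t))) (Icc 0 T) t)
    (hA : ∀ t, A t = poseErr (pose (Qd t) (Pd t)) (pose (Q t) (P t)))
    (hx : ∀ t, x t = velErr (A t) (u t) (ω t))
    (hσ : ∀ t ∈ Icc 0 T, IsSgnSelection (σ t) (x t))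
    (hf : ∀ t ∈ Icc 0 T, f t = control kp kd (θ t) (σ t) (A t) (x t) (u t) (u' t))
    (hD : ∀ t ∈ Icc 0 T, ‖D t‖ ≤ β) (hac : AbsolutelyContinuousOnInterval ω 0 T)
    (hdyn : ∀ᵐ t ∂(volume.restrict (Icc 0 T)), ∃ α : DualVec, HasDerivAt ω α t ∧
      inertia m J α = -dualCross (ω t) (inertia m J (ω t)) + f t + D t)
    (hA₀ : A 0 = ς • (1 : DualQuat)) (hx₀ : x 0 = 0) :
    IsErrorTrajectory m J T kp kd W β ς u u' θ A x := by
  have hω : ω = fun t => x t + tr (A t) (u t) :=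
    funext fun t => by rw [hx, velErr, sub_add_cancel]
  rw [ae_restrict_iff' measurableSet_Icc] at hdyn
  refine ⟨hu, hW, hW', fun t ht => ?_, fun t ht => ?_, hω ▸ hac, ?_, hA₀, hx₀⟩
  · rw [hx, funext hA]
    exact hasDerivWithinAt_poseErr (hkind t ht) (hkin t ht) (conj_mul_pose (hQd t ht) _)
      (pose_mul_conj (hQ t ht) _)
  · rw [hA]
    exact norm_re_poseErr (hQd t ht) (hQ t ht) _ _
  · filter_upwards [hdyn] with t hnewton ht
    obtain ⟨α, hα, hforce⟩ := hnewton ht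
    rw [hf t ht, add_assoc] at hforce
    subst hω
    exact ⟨α, σ t, D t, hα, hσ t ht, hD t ht, hforce⟩

theorem isLearningUpdate_of_proj {s : ℕ} {h : ℕ → ℝ} {kc kl kθ T : ℝ} {θ : ℕ → ℝ → ℝ}
    {A : ℕ → ℝ → DualQuat} {u u' : ℝ → DualVec} {x : ℕ → ℝ → DualVec}
    (hθ₀ : ∀ t ∈ Icc 0 T, θ 0 t = 0)
    (hθ : ∀ k, ∀ t ∈ Icc 0 T, θ (k + 1) t - proj s h kc (θ k) t = min kl (kθ *
      crs (x (k + 1) t) (func (x (k + 1) t) (tr (A (k + 1) t) (u t)) (tr (A (k + 1) t) (u' t))))) :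
    IsLearningUpdate kc kl kθ (Icc 0 T) (segment s h) θ
      fun k t => learningSignal (A k t) (u t) (u' t) (x k t) where
  zero := hθ₀
  succ k t ht := by
    rw [← proj_eq_max]
    exact sub_eq_iff_eq_add'.1 (hθ k t ht)
  signal_nonneg _ _ _ := (norm_nonneg _).trans (norm_le_learningSignal ..)

theorem exists_bound_of_disturbance {S : Set ℝ} {d τ : ℕ → ℝ → E3} {βd βs : ℝ → ℝ}
    (hβd : ∃ B, ∀ t ∈ S, βd t ≤ B) (hβs : ∃ B, ∀ t ∈ S, βs t ≤ B)
    (hd : ∀ k, ∀ t ∈ S, ‖d k t‖ ≤ βd t) (hτ : ∀ k, ∀ t ∈ S, ‖τ k t‖ ≤ βs t) :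
    ∃ β, 0 ≤ β ∧ ∀ k, ∀ t ∈ S, ‖(d k t, τ k t)‖ ≤ β := by
  obtain ⟨Bd, hBd⟩ := hβd
  obtain ⟨Bs, hBs⟩ := hβs
  exact ⟨max 0 (max Bd Bs), le_max_left _ _, fun k t ht => le_max_of_le_right <|
    max_le_max ((hd k t ht).trans (hBd t ht)) ((hτ k t ht).trans (hBs t ht))⟩

theorem exists_norm_control_bound (kp kd W B : ℝ) :
    ∃ M, ∀ (θ : ℝ) (σ : DualVec) (A : DualQuat) (x u u' : DualVec), IsSgnSelection σ x →
      ‖re A‖ = 1 → ‖du A‖ ≤ B → ‖x‖ ≤ B → |θ| ≤ B → ‖u‖ ≤ W → ‖u'‖ ≤ W →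
        ‖control kp kd θ σ A x u u'‖ ≤ M := by
  refine ⟨B * ((W ^ 2 + W + 1) * (1 + 2 * B) * 3) + (|kd| * B + |kp| * (1 + B)),
    fun θ σ A x u u' hσ hre hdu hx hθ hu hu' => (norm_control_le hσ kp kd θ hre hu hu').trans ?_⟩
  have hB : 0 ≤ B := (norm_nonneg _).trans hx
  have hW : 0 ≤ W := (norm_nonneg _).trans hu
  gcongr

end ClosedLoop

end DualILC

end

theorem theorem2_general
    (m : ℝ) (hm : 0 < m) (J : Matrix (Fin 3) (Fin 3) ℝ) (hJ : J.PosDef)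
    (T : ℝ) (s : ℕ) (hs : 1 ≤ s) (h : ℕ → ℝ) (h0 : h 0 = 0) (hT : h s = T)
    (hmono : ∀ j < s, h j < h (j + 1))
    (kp kd kc kθ kl : ℝ) (hkc : 0 ≤ kc) (hkθ : 0 < kθ) (hkl : 0 < kl)
    (Qd : ℝ → Quaternion ℝ) (Pd : ℝ → DualILC.E3) (ωd ωd' : ℝ → DualILC.DualVec)
    (hQd : ∀ t ∈ Set.Icc 0 T, ‖Qd t‖ = 1)
    (hQd' : ∀ t ∈ Set.Icc 0 T, HasDerivWithinAt (fun τ => DualILC.pose (Qd τ) (Pd τ))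
      ((1 / 2 : ℝ) • (DualILC.pose (Qd t) (Pd t) * DualILC.dualAug (ωd t))) (Set.Icc 0 T) t)
    (hωd' : ∀ t ∈ Set.Icc 0 T, HasDerivWithinAt ωd (ωd' t) (Set.Icc 0 T) t)
    (hωd'_bdd : ∃ B : ℝ, ∀ t ∈ Set.Icc 0 T, ‖ωd' t‖ ≤ B)
    (d τd : ℕ → ℝ → DualILC.E3) (βd βs : ℝ → ℝ)
    (hβd : ∃ B : ℝ, ∀ t ∈ Set.Icc 0 T, βd t ≤ B) (hβs : ∃ B : ℝ, ∀ t ∈ Set.Icc 0 T, βs t ≤ B)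
    (hd : ∀ k, ∀ t ∈ Set.Icc 0 T, ‖d k t‖ ≤ βd t)
    (hτd : ∀ k, ∀ t ∈ Set.Icc 0 T, ‖τd k t‖ ≤ βs t)
    (Q : ℕ → ℝ → Quaternion ℝ) (P : ℕ → ℝ → DualILC.E3) (ω : ℕ → ℝ → DualILC.DualVec)
    (hQ : ∀ k, ∀ t ∈ Set.Icc 0 T, ‖Q k t‖ = 1)
    (δQ : ℕ → ℝ → DualILC.DualQuat) (δω : ℕ → ℝ → DualILC.DualVec)
    (hδQ : ∀ k t, δQ k t =
      DualILC.poseErr (DualILC.pose (Qd t) (Pd t)) (DualILC.pose (Q k t) (P k t)))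
    (hδω : ∀ k t, δω k t = DualILC.velErr (δQ k t) (ωd t) (ω k t))
    (θhat : ℕ → ℝ → ℝ) (σ f : ℕ → ℝ → DualILC.DualVec)
    (hσ : ∀ k, ∀ t ∈ Set.Icc 0 T, DualILC.IsSgnSelection (σ k t) (δω k t))
    (hf : ∀ k, ∀ t ∈ Set.Icc 0 T, f k t =
      DualILC.control kp kd (θhat k t) (σ k t) (δQ k t) (δω k t) (ωd t) (ωd' t))
    (hkin : ∀ k, ∀ t ∈ Set.Icc 0 T, HasDerivWithinAt (fun τ => DualILC.pose (Q k τ) (P k τ))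
      ((1 / 2 : ℝ) • (DualILC.pose (Q k t) (P k t) * DualILC.dualAug (ω k t))) (Set.Icc 0 T) t)
    (hac : ∀ k, AbsolutelyContinuousOnInterval (ω k) 0 T)
    (hdyn : ∀ k, ∀ᵐ t ∂(MeasureTheory.volume.restrict (Set.Icc 0 T)),
      ∃ a : DualILC.DualVec, HasDerivAt (ω k) a t ∧
        DualILC.inertia m J a =
          -DualILC.dualCross (ω k t) (DualILC.inertia m J (ω k t)) + f k t + (d k t, τd k t))
    (sg : ℕ → ℝ) (hsg : ∀ k, sg k = 1 ∨ sg k = -1)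
    (hinitQ : ∀ k, δQ k 0 = sg k • (1 : DualILC.DualQuat))
    (hinitω : ∀ k, δω k 0 = 0)
    (hθ0 : ∀ t ∈ Set.Icc 0 T, θhat 0 t = 0)
    (hθ : ∀ k, ∀ t ∈ Set.Icc 0 T, θhat (k + 1) t - DualILC.proj s h kc (θhat k) t =
      min kl (kθ * DualILC.crs (δω (k + 1) t)
        (DualILC.func (δω (k + 1) t) (DualILC.tr (δQ (k + 1) t) (ωd t))
          (DualILC.tr (δQ (k + 1) t) (ωd' t))))) :
    (∀ t ∈ Set.Icc 0 T,
      Filter.Tendsto (fun k => ‖DualILC.posErr (Qd t) (Pd t) (Q k t) (P k t)‖)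
        Filter.atTop (nhds 0) ∧
      Filter.Tendsto (fun k => ‖DualILC.attErr (Qd t) (Q k t)‖) Filter.atTop (nhds 0) ∧
      Filter.Tendsto (fun k => sg k • DualILC.pose (Q k t) (P k t))
        Filter.atTop (nhds (DualILC.pose (Qd t) (Pd t)))) ∧
    (∃ B : ℝ, ∀ k, ∀ t ∈ Set.Icc 0 T,
      ‖(f k t).1‖ ≤ B ∧ ‖(f k t).2‖ ≤ B ∧
      ‖DualILC.re (δQ k t)‖ ≤ B ∧ ‖DualILC.du (δQ k t)‖ ≤ B ∧
      ‖(δω k t).1‖ ≤ B ∧ ‖(δω k t).2‖ ≤ B ∧ |θhat k t| ≤ B) := by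
  subst hT
  have hh : StrictMonoOn h (Set.Iic s) := strictMonoOn_of_lt_add_one Set.ordConnected_Iic
    fun j _ _ hj => hmono j (Nat.lt_of_succ_le hj)
  obtain ⟨W, hW, hW'⟩ := DualILC.exists_bound_of_hasDerivWithinAt hωd' hωd'_bdd
  obtain ⟨β, hβ, hD⟩ := DualILC.exists_bound_of_disturbance hβd hβs hd hτd
  have H (k) := DualILC.isErrorTrajectory_of_closedLoop hQd (hQ k) hωd' hW hW' hQd' (hkin k)
    (hδQ k) (hδω k) (hσ k) (hf k) (hD k) (hac k) (hdyn k) (hinitQ k) (hinitω k)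
  obtain ⟨B, hB⟩ := DualILC.exists_bound_of_isLearningUpdate hm hJ hβ hs h0 hh hkc hkl hkθ H
    (DualILC.isLearningUpdate_of_proj hθ0 hθ)
  constructor
  · intro t ht
    obtain ⟨hre, hdu⟩ := DualILC.tendsto_poseErr_of_sum_le H (fun t ht n => (hB t ht n).1)
      (fun k t ht => (hB t ht k).2.2.1) ht
    simp only [hδQ] at hre hdu
    exact DualILC.tendsto_tracking_of_tendsto_poseErr (hQd t ht) (fun k => hQ k t ht) hsg hre hdu
  · obtain ⟨M, hM⟩ := DualILC.exists_norm_control_bound kp kd W B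
    refine ⟨max M (max 1 B), fun k t ht => ?_⟩
    obtain ⟨-, hx, hdu, hθB⟩ := hB t ht k
    have hre := (H k).norm_re t ht
    have hfM := hM _ _ _ _ _ _ (hσ k t ht) hre hdu hx hθB (hW t ht) (hW' t ht)
    rw [← hf k t ht] at hfM
    simp only [le_max_iff]
    exact ⟨.inl ((norm_fst_le _).trans hfM), .inl ((norm_snd_le _).trans hfM), .inr (.inl hre.le),
      .inr (.inr hdu), .inr (.inr ((norm_fst_le _).trans hx)),
      .inr (.inr ((norm_snd_le _).trans hx)), .inr (.inr hθB)⟩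

theorem theorem2
    -- the rigid body
    (m : ℝ) (hm : 0 < m) (J : Matrix (Fin 3) (Fin 3) ℝ) (hJ : J.PosDef)
    -- the segments `0 = h 0 < h 1 < ⋯ < h s = T`
    (T : ℝ) (s : ℕ) (hs : 1 ≤ s) (h : ℕ → ℝ) (h0 : h 0 = 0) (hT : h s = T)
    (hmono : ∀ j < s, h j < h (j + 1))
    -- the gains
    (kp kd kc kθ kl : ℝ) (hkp : 0 < kp) (hkd : 0 < kd) (hkc : 0 < kc) (hkθ : 0 < kθ) (hkl : 0 < kl)
    -- the desired trajectory: attitude, position, dual velocity and its derivative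
    (Qd : ℝ → Quaternion ℝ) (Pd : ℝ → DualILC.E3) (ωd ωd' : ℝ → DualILC.DualVec)
    (hQd : ∀ t ∈ Set.Icc 0 T, ‖Qd t‖ = 1)
    (hQd' : ∀ t ∈ Set.Icc 0 T, HasDerivWithinAt (fun τ => DualILC.pose (Qd τ) (Pd τ))
      ((1 / 2 : ℝ) • (DualILC.pose (Qd t) (Pd t) * DualILC.dualAug (ωd t))) (Set.Icc 0 T) t)
    (hωd' : ∀ t ∈ Set.Icc 0 T, HasDerivWithinAt ωd (ωd' t) (Set.Icc 0 T) t)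
    (hωd'_bdd : ∃ B : ℝ, ∀ t ∈ Set.Icc 0 T, ‖ωd' t‖ ≤ B)
    -- the disturbance force and torque, bounded uniformly in the iteration
    (d τd : ℕ → ℝ → DualILC.E3) (βd βs : ℝ → ℝ)
    (hβd : ∃ B : ℝ, ∀ t ∈ Set.Icc 0 T, βd t ≤ B) (hβs : ∃ B : ℝ, ∀ t ∈ Set.Icc 0 T, βs t ≤ B)
    (hd : ∀ k, ∀ t ∈ Set.Icc 0 T, ‖d k t‖ ≤ βd t)
    (hτd : ∀ k, ∀ t ∈ Set.Icc 0 T, ‖τd k t‖ ≤ βs t)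
    -- attitude, position and dual velocity in iteration `k`
    (Q : ℕ → ℝ → Quaternion ℝ) (P : ℕ → ℝ → DualILC.E3) (ω : ℕ → ℝ → DualILC.DualVec)
    (hQ : ∀ k, ∀ t ∈ Set.Icc 0 T, ‖Q k t‖ = 1)
    -- the errors
    (δQ : ℕ → ℝ → DualILC.DualQuat) (δω : ℕ → ℝ → DualILC.DualVec)
    (hδQ : ∀ k t, δQ k t =
      DualILC.poseErr (DualILC.pose (Qd t) (Pd t)) (DualILC.pose (Q k t) (P k t)))
    (hδω : ∀ k t, δω k t = DualILC.velErr (δQ k t) (ωd t) (ω k t))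
    -- the value of the (set-valued) sign of the velocity error, and the control input
    (θhat : ℕ → ℝ → ℝ) (σ f : ℕ → ℝ → DualILC.DualVec)
    (hσ : ∀ k, ∀ t ∈ Set.Icc 0 T, DualILC.IsSgnSelection (σ k t) (δω k t))
    (hf : ∀ k, ∀ t ∈ Set.Icc 0 T, f k t =
      DualILC.control kp kd (θhat k t) (σ k t) (δQ k t) (δω k t) (ωd t) (ωd' t))
    -- kinematics
    (hkin : ∀ k, ∀ t ∈ Set.Icc 0 T, HasDerivWithinAt (fun τ => DualILC.pose (Q k τ) (P k τ))
      ((1 / 2 : ℝ) • (DualILC.pose (Q k t) (P k t) * DualILC.dualAug (ω k t))) (Set.Icc 0 T) t)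
    -- dynamics
    (hac : ∀ k, AbsolutelyContinuousOnInterval (ω k) 0 T)
    (hdyn : ∀ k, ∀ᵐ t ∂(MeasureTheory.volume.restrict (Set.Icc 0 T)),
      ∃ a : DualILC.DualVec, HasDerivAt (ω k) a t ∧
        DualILC.inertia m J a =
          -DualILC.dualCross (ω k t) (DualILC.inertia m J (ω k t)) + f k t + (d k t, τd k t))
    -- the initial conditions `δQ k 0 = ±1 + ε 0`, `δω k 0 = 0 + ε 0`
    (sg : ℕ → ℝ) (hsg : ∀ k, sg k = 1 ∨ sg k = -1)
    (hinitQ : ∀ k, δQ k 0 = sg k • (1 : DualILC.DualQuat))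
    (hinitω : ∀ k, δω k 0 = 0)
    -- the saturated iterative updating law
    (hθ0 : ∀ t ∈ Set.Icc 0 T, θhat 0 t = 0)
    (hθ : ∀ k, ∀ t ∈ Set.Icc 0 T, θhat (k + 1) t - DualILC.proj s h kc (θhat k) t =
      min kl (kθ * DualILC.crs (δω (k + 1) t)
        (DualILC.func (δω (k + 1) t) (DualILC.tr (δQ (k + 1) t) (ωd t))
          (DualILC.tr (δQ (k + 1) t) (ωd' t))))) :
    -- perfect position-attitude tracking
    (∀ t ∈ Set.Icc 0 T,
      Filter.Tendsto (fun k => ‖DualILC.posErr (Qd t) (Pd t) (Q k t) (P k t)‖)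
        Filter.atTop (nhds 0) ∧
      Filter.Tendsto (fun k => ‖DualILC.attErr (Qd t) (Q k t)‖) Filter.atTop (nhds 0) ∧
      Filter.Tendsto (fun k => sg k • DualILC.pose (Q k t) (P k t))
        Filter.atTop (nhds (DualILC.pose (Qd t) (Pd t)))) ∧
    -- boundedness of inputs, errors and estimates, uniform in time and iteration
    (∃ B : ℝ, ∀ k, ∀ t ∈ Set.Icc 0 T,
      ‖(f k t).1‖ ≤ B ∧ ‖(f k t).2‖ ≤ B ∧
      ‖DualILC.re (δQ k t)‖ ≤ B ∧ ‖DualILC.du (δQ k t)‖ ≤ B ∧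
      ‖(δω k t).1‖ ≤ B ∧ ‖(δω k t).2‖ ≤ B ∧ |θhat k t| ≤ B) :=
  theorem2_general m hm J hJ T s hs h h0 hT hmono _ _ _ _ _ hkc.le hkθ hkl _ _ _ _ hQd hQd' hωd'
    hωd'_bdd _ _ _ _ hβd hβs hd hτd _ _ _ hQ _ _ hδQ hδω _ _ _ hσ hf hkin hac hdyn _ hsg hinitQ
    hinitω hθ0 hθ
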